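/- Let $(S,\mathcal S)$ be a measurable space, $P$ a probability measure on it, and $X_1,X_2,\dots$ i.i.d. $S$-valued random variables with law $P$, defined on a probability space $\Omega$; let $P_n=n^{-1}\sum_{i=1}^n\delta_{X_i}$. Let $\mathcal F$ be a class of measurable functions $f:S\to[-1,1]$ with $Pf=0$, suitably measurable in the sense that for all $n$ and all real $a_1,\dots,a_n$ the functions $\sup_{f\in\mathcal F}|\sum_{i}a_if(x_i)|$ and $\sup_{f\in\mathcal F}|\sum_{i}a_if(x_i)^2|$ of $(x_1,\dots,x_n)\in S^n$ are measurable for the completion of $P^n$ (for instance, $\mathcal F$ countable). Let $F\le 1$ be a measurable envelope of $\mathcal F$ (that is, $|f|\le F$ for all $f\in\mathcal F$), put $\|F\|_2=\|F\|_{L_2(P)}$, $\|F\|_{2,n}=\|F\|_{L_2(P_n)}$, $\|\psi(f)\|_{\mathcal F}=\sup_{f\in\mathcal F}|\psi(f)|$, and let $\sigma>0$ satisfy $$\sup_{f\in\mathcal F}Pf^2\le\sigma^2\le\|F\|_2^2 .$$ Let $H:[0,\infty)\to[0,\infty)$ be regularly varying at infinity of some exponent $0\le\alpha<2$, strictly increasing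 on $[1/2,\infty)$, with $H(x)=0$ for $0\le x<1/2$, and let $C_H,D_H,A_H$ be finite numbers such that $$C_H\ge\sup_{x\ge1}\frac{\int_x^\infty u^{-2}\sqrt{H(u)}\,du}{x^{-1}\sqrt{H(x)}}\vee1,\qquad D_H\ge\int_1^\infty u^{-2}\sqrt{H(u)}\,du,\qquad A_H\ge\sup_{x\ge2}\frac{\log\big(D_Hx/(4C_H\sqrt{H(x)})\big)}{x^2}\vee1 .$$ Let $N(\mathcal F,L_2(P_n),\tau)$ be the smallest number of open $L_2(P_n)$-balls of radius at most $\tau$, with centers in $\mathcal F$, that cover $\mathcal F$. **Theorem.** Suppose that $$\log N(\mathcal F,L_2(P_n),\tau)\le H\!\left(\frac{\|F\|_{2,n}}{\tau}\right)\qquad\text{for all }\tau>0,\ n\ge 1,\ \omega\in\Omega .$$ Then there is a constant $C(H)>0$, depending only on $A_H$, $C_H$ and $D_H$, such that for all $n\ge1$ $$\frac1{C(H)}\,E\Big\|\sum_{i=1}^nf(X_i)\Big\|_{\mathcal F}\le\big[\sqrt n\,\|F\|_2\big]\wedge\left[\left(\sqrt n\,\sigma\sqrt{H\Big(\frac{2\|F\|_2}{\sigma}\Big)}\right)\vee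 H\left(\frac{2\|F\|_2}{\sigma}\wedge\frac{\sqrt n\,\|F\|_2}{1440\,C_H}\right)\vee1\right]$$ and $$\frac1{C(H)}\,E\Big\|\sum_{i=1}^nf(X_i)\Big\|_{\mathcal F}\le\left[\sqrt n\,\sigma\sqrt{H\Big(\frac{2\|F\|_2}{\sigma}\Big)}\right]\vee H\Big(\frac{2\|F\|_2}{\sigma}\Big).$$ Moreover, for every $c>0$ there is a constant $K(H,c)$, depending only on $H$ and $c$, such that whenever $n\ge1$ and $n\sigma^2\ge c\,H(2\|F\|_2/\sigma)$, $$E\Big\|\sum_{i=1}^nf(X_i)\Big\|_{\mathcal F}\le K(H,c)\,\sqrt n\,\sigma\sqrt{H\Big(\frac{2\|F\|_2}{\sigma}\Big)} .$$ -/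

import Mathlib

open MeasureTheory ProbabilityTheory Filter Topology Set

namespace EmpiricalEntropy

/-- `‖ψ(f)‖_𝓕 = sup_{f ∈ 𝓕} |ψ(f)|`. -/
noncomputable def supNorm {S : Type*} (𝓕 : Set (S → ℝ)) (ψ : (S → ℝ) → ℝ) : ℝ :=
  ⨆ f : 𝓕, |ψ f|

/-- The norm of `L₂(Q)`: `‖g‖_{L₂(Q)} = (∫ g² dQ)^{1/2}`. -/
noncomputable def l2norm {S : Type*} [MeasurableSpace S] (Q : Measure S) (g : S → ℝ) : ℝ :=
  √(∫ x, g x ^ 2 ∂Q)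

/-- The empirical measure `n⁻¹ ∑_{i < n} δ_{x i}` of the first `n` points of a sequence. -/
noncomputable def empiricalMeasure {S : Type*} [MeasurableSpace S] (n : ℕ) (x : ℕ → S) :
    Measure S :=
  (n : ENNReal)⁻¹ • ∑ i ∈ Finset.range n, Measure.dirac (x i)

/-- The covering number `N(𝓕, L₂(Q), ε)`: the smallest number of open `L₂(Q)`-balls of radius `ε`
with centers in `𝓕` needed to cover `𝓕`; it is `⊤` when no finite number is enough.
(Allowing some of the balls to have a smaller radius does not change this number.) -/
noncomputable def coveringNumber {S : Type*} [MeasurableSpace S] (𝓕 : Set (S → ℝ))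
    (Q : Measure S) (ε : ℝ) : ℕ∞ :=
  ⨅ (t : Set (S → ℝ)) (_ : t ⊆ 𝓕) (_ : ∀ f ∈ 𝓕, ∃ g ∈ t, l2norm Q (f - g) < ε), t.encard

/-- The metric entropy `log N(𝓕, L₂(Q), ε)`, with value `⊤` when the covering number is
infinite. -/
noncomputable def entropy {S : Type*} [MeasurableSpace S] (𝓕 : Set (S → ℝ))
    (Q : Measure S) (ε : ℝ) : EReal :=
  ENNReal.log ((coveringNumber 𝓕 Q ε : ℕ∞) : ENNReal)

/-- `H` is regularly varying (at infinity) of exponent `α`. -/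
def RegularlyVarying (H : ℝ → ℝ) (α : ℝ) : Prop :=
  ∀ l : ℝ, 0 < l → Tendsto (fun x => H (l * x) / H x) atTop (𝓝 (l ^ α))

/-- The functions `H : [0, ∞) → [0, ∞)` used as entropy bounds: regularly varying of some exponent
`0 ≤ α < 2`, strictly increasing on `[1/2, ∞)`, and zero on `[0, 1/2)`.
The values of `H` on the negative half-line play no role. -/
structure IsEntropyBound (H : ℝ → ℝ) : Prop where
  nonneg : ∀ x, 0 ≤ x → 0 ≤ H x
  regularlyVarying : ∃ α : ℝ, 0 ≤ α ∧ α < 2 ∧ RegularlyVarying H α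
  strictMonoOn : StrictMonoOn H (Ici (1 / 2))
  eq_zero : ∀ x, 0 ≤ x → x < 1 / 2 → H x = 0

/-- The finite numbers `A`, `C`, `D` are admissible values of the constants `A_H`, `C_H`, `D_H`:
`C ≥ (sup_{x ≥ 1} (∫_x^∞ u⁻² √H(u) du) / (x⁻¹ √H(x))) ∨ 1`, `D ≥ ∫_1^∞ u⁻² √H(u) du` and
`A ≥ (sup_{x ≥ 2} x⁻² log (D x / (4 C √H(x)))) ∨ 1`. The integrals are Lebesgue integrals of
nonnegative functions with values in `[0, ∞]`, so their finiteness is part of the condition. -/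
structure AdmissibleConstants (H : ℝ → ℝ) (A C D : ℝ) : Prop where
  one_le_C : 1 ≤ C
  tail_le : ∀ x : ℝ, 1 ≤ x →
    (∫⁻ u in Ioi x, ENNReal.ofReal (√(H u) / u ^ 2)) / ENNReal.ofReal (√(H x) / x)
      ≤ ENNReal.ofReal C
  integral_le : (∫⁻ u in Ioi (1 : ℝ), ENNReal.ofReal (√(H u) / u ^ 2)) ≤ ENNReal.ofReal D
  one_le_A : 1 ≤ A
  log_le : ∀ x : ℝ, 2 ≤ x → Real.log (D * x / (4 * C * √(H x))) / x ^ 2 ≤ A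

/-- The class `𝓕` is suitably measurable for `P`: for all `n` and all real `a₁, …, aₙ` the suprema
`‖∑ aᵢ f(xᵢ)‖_𝓕` and `‖∑ aᵢ f(xᵢ)²‖_𝓕` are measurable functions of `(x₁, …, xₙ)` for the
completion of `Pⁿ`. Uniformly bounded classes of measurable functions that are countable, or more
generally image admissible Suslin, have this property. -/
def SuitablyMeasurable {S : Type*} [MeasurableSpace S] (P : Measure S) (𝓕 : Set (S → ℝ)) : Prop :=
  ∀ (n : ℕ) (a : Fin n → ℝ),
    AEMeasurable (fun x : Fin n → S => supNorm 𝓕 fun f => ∑ i, a i * f (x i))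
      (Measure.pi fun _ => P) ∧
    AEMeasurable (fun x : Fin n → S => supNorm 𝓕 fun f => ∑ i, a i * f (x i) ^ 2)
      (Measure.pi fun _ => P)

/-- Standing assumptions on the class `𝓕`, its envelope `F` and the number `σ`: `𝓕` is a suitably
measurable class of measurable `P`-centered functions, `F ≤ 1` is a measurable envelope of `𝓕`
(so that the functions in `𝓕` take values in `[-1, 1]`), `σ > 0` and
`sup_{f ∈ 𝓕} P f² ≤ σ² ≤ ‖F‖₂²`. -/
structure IsCenteredClass {S : Type*} [MeasurableSpace S] (P : Measure S) (𝓕 : Set (S → ℝ))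
    (F : S → ℝ) (σ : ℝ) : Prop where
  measurable : ∀ f ∈ 𝓕, Measurable f
  suitablyMeasurable : SuitablyMeasurable P 𝓕
  centered : ∀ f ∈ 𝓕, ∫ x, f x ∂P = 0
  envelope_measurable : Measurable F
  abs_le_envelope : ∀ f ∈ 𝓕, ∀ x, |f x| ≤ F x
  envelope_le_one : ∀ x, F x ≤ 1
  sigma_pos : 0 < σ
  variance_le : ∀ f ∈ 𝓕, ∫ x, f x ^ 2 ∂P ≤ σ ^ 2
  sigma_le : σ ^ 2 ≤ l2norm P F ^ 2

/-- `X 0, X 1, …` are independent random variables with common law `P`. -/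
structure IsSample {Ω S : Type*} [MeasurableSpace Ω] [MeasurableSpace S] (μ : Measure Ω)
    (P : Measure S) (X : ℕ → Ω → S) : Prop where
  measurable : ∀ i, Measurable (X i)
  map_eq : ∀ i, μ.map (X i) = P
  indep : iIndepFun X μ

/-- The random entropy condition: `log N(𝓕, L₂(Pₙ), τ) ≤ H(‖F‖_{L₂(Pₙ)} / τ)` for all `τ > 0`, all
`n ≥ 1` and all `ω`, where `Pₙ` is the empirical measure of the first `n` observations. -/
def EntropyCondition {Ω S : Type*} [MeasurableSpace S] (X : ℕ → Ω → S) (𝓕 : Set (S → ℝ))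
    (F : S → ℝ) (H : ℝ → ℝ) : Prop :=
  ∀ τ : ℝ, 0 < τ → ∀ n : ℕ, 1 ≤ n → ∀ ω : Ω,
    entropy 𝓕 (empiricalMeasure n fun i => X i ω) τ
      ≤ ((H (l2norm (empiricalMeasure n fun i => X i ω) F / τ) : ℝ) : EReal)

/-- The random variable `‖∑_{i < n} f(X i)‖_𝓕`. -/
noncomputable def supSum {Ω S : Type*} (X : ℕ → Ω → S) (𝓕 : Set (S → ℝ)) (n : ℕ) (ω : Ω) : ℝ :=
  supNorm 𝓕 fun f => ∑ i ∈ Finset.range n, f (X i ω)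

end EmpiricalEntropy

open EmpiricalEntropy

universe u v

namespace EmpiricalEntropy

/-! Write `t = ‖F‖₂`, and let `u` be the mean of the largest empirical second moment `sup Pₙ f²`.
Everything rests on two inequalities, valid at each scale `s ≤ t` with `u ≤ s²`: the mean of the
supremum is at most `K √n s √H(2t/s)` (`integral_supNorm_le`), and `n u ≤ n σ² + 2K √n s √H(2t/s)`
(`integral_maxSecondMoment_le`). Both come from symmetrization followed by chaining conditionally on
the sample; the second is the same argument for the class of the `f²/2`, where squaring is harmless
because `a ↦ a²/2` is a contraction of `[-1, 1]`.

Conditionally on the sample, Dudley's bound has the random scales `√(sup Pₙ f²)` and `√(Pₙ F²)`.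
`DyadicBound.mul_sqrt_le` dominates `s √H(2t/s)` by a linear function of `(s, t)`, and the
arithmetic-geometric inequality removes the square roots, so integration only needs the means `u`
and `t²`. This takes the place of a concavity argument.

The inequality for `u` is self-bounding (`le_or_le_entropy`). If `u ≤ 2σ²`, the scale `max σ √u`
gives the variance term. Otherwise `nσ²` is absorbed by `n u`, so `√(n u)` is at most a multiple of
`√H(2t/√u)` and the mean is at most a multiple of `H(2t/√u)`. `bounds_of_self_bounding` turns this
alternative into the stated bounds.

All that is used of `H` is collected in `DyadicBound`. It follows from the admissible constants,
with parameters depending on them alone (`IsEntropyBound.dyadicBound`), and also from regular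
variation of exponent below 2 (`IsEntropyBound.exists_dyadicBound`), which suffices for the last
bound. -/

/-- The sign `1` or `-1` encoded by a boolean. -/
def boolSign (b : Bool) : ℝ := if b then 1 else -1

lemma boolSign_sq (b : Bool) : boolSign b ^ 2 = 1 := by cases b <;> simp [boolSign]

lemma abs_boolSign (b : Bool) : |boolSign b| = 1 := by cases b <;> simp [boolSign]

/-- The mean of a function of `n` independent uniform signs. -/
noncomputable def signMean {n : ℕ} (M : (Fin n → Bool) → ℝ) : ℝ := (∑ e, M e) / 2 ^ n

/-! ### Rademacher averages: maximal inequality and chaining -/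

section SignMean

variable {n : ℕ}

lemma signMean_mono {M M' : (Fin n → Bool) → ℝ} (h : ∀ e, M e ≤ M' e) :
    signMean M ≤ signMean M' := by
  unfold signMean
  gcongr
  exact h _

lemma signMean_add (M M' : (Fin n → Bool) → ℝ) :
    signMean (fun e => M e + M' e) = signMean M + signMean M' := by
  simp [signMean, Finset.sum_add_distrib, add_div]

lemma signMean_const (c : ℝ) : signMean (fun _ : Fin n → Bool => c) = c := by
  simp [signMean]

lemma signMean_const_mul (c : ℝ) (M : (Fin n → Bool) → ℝ) :
    signMean (fun e => c * M e) = c * signMean M := by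
  simp [signMean, ← Finset.mul_sum, mul_div_assoc]

lemma signMean_sum {κ : Type*} (J : Finset κ) (M : κ → (Fin n → Bool) → ℝ) :
    signMean (fun e => ∑ j ∈ J, M j e) = ∑ j ∈ J, signMean (M j) := by
  simp only [signMean]
  rw [Finset.sum_comm, Finset.sum_div]

/-- Rademacher sums are sub-Gaussian. -/
lemma signMean_exp_le (w : Fin n → ℝ) :
    signMean (fun e => Real.exp (∑ i, boolSign (e i) * w i))
      ≤ Real.exp ((∑ i, w i ^ 2) / 2) := by
  have h1 : ∑ e : Fin n → Bool, Real.exp (∑ i, boolSign (e i) * w i)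
      = ∏ i, ∑ b : Bool, Real.exp (boolSign b * w i) := by
    rw [Finset.prod_univ_sum, Fintype.piFinset_univ]
    simp only [Real.exp_sum]
  have h2 : ∀ i, ∑ b : Bool, Real.exp (boolSign b * w i) = 2 * Real.cosh (w i) := by
    intro i
    simp [boolSign, Real.cosh_eq]
    ring
  unfold signMean
  rw [h1, Finset.prod_congr rfl fun i _ => h2 i, Finset.prod_mul_distrib, Finset.sum_div,
    Real.exp_sum]
  simp only [Finset.prod_const, Finset.card_univ, Fintype.card_fin]
  rw [mul_div_cancel_left₀ _ (by positivity)]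
  exact Finset.prod_le_prod (fun i _ => (Real.cosh_pos _).le) fun i _ =>
    Real.cosh_le_exp_half_sq _

/-- The exponential of an absolute value is at most the sum of the exponentials for the two signs,
whence the factor 2. -/
lemma signMean_exp_abs_le (w : Fin n → ℝ) {l r : ℝ} (hw : ∑ i, w i ^ 2 ≤ r ^ 2) :
    signMean (fun e => Real.exp (l * |∑ i, boolSign (e i) * w i|))
      ≤ 2 * Real.exp (l ^ 2 * r ^ 2 / 2) := by
  have key : ∀ c : ℝ, c ^ 2 = l ^ 2 →
      signMean (fun e => Real.exp (c * ∑ i, boolSign (e i) * w i))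
        ≤ Real.exp (l ^ 2 * r ^ 2 / 2) := by
    intro c hc
    have h := signMean_exp_le fun i => c * w i
    have e1 : ∀ e : Fin n → Bool,
        ∑ i, boolSign (e i) * (c * w i) = c * ∑ i, boolSign (e i) * w i := by
      intro e
      rw [Finset.mul_sum]
      exact Finset.sum_congr rfl fun i _ => by ring
    simp only [e1, mul_pow, ← Finset.mul_sum, hc] at h
    refine h.trans (Real.exp_le_exp.2 ?_)
    gcongr
  calc signMean (fun e => Real.exp (l * |∑ i, boolSign (e i) * w i|))
      ≤ signMean (fun e => Real.exp (l * ∑ i, boolSign (e i) * w i)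
          + Real.exp (-l * ∑ i, boolSign (e i) * w i)) := by
        refine signMean_mono fun e => ?_
        rcases abs_cases (∑ i, boolSign (e i) * w i) with ⟨h, -⟩ | ⟨h, -⟩ <;> rw [h]
        · linarith [Real.exp_pos (-l * ∑ i, boolSign (e i) * w i)]
        · rw [mul_neg, ← neg_mul]
          linarith [Real.exp_pos (l * ∑ i, boolSign (e i) * w i)]
    _ ≤ 2 * Real.exp (l ^ 2 * r ^ 2 / 2) := by
        rw [signMean_add]
        linarith [key l rfl, key (-l) (neg_sq l)]

/-- Maximal inequality for finitely many Rademacher sums. -/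
lemma exists_bound_signMean_le {κ : Type*} (J : Finset κ) (w : κ → Fin n → ℝ) {r l : ℝ}
    (hr : 0 < r) (hl : 0 ≤ l) (hJ : (J.card : ℝ) ≤ Real.exp l)
    (hw : ∀ j ∈ J, ∑ i, w j i ^ 2 ≤ r ^ 2) :
    ∃ M : (Fin n → Bool) → ℝ, (∀ e, ∀ j ∈ J, |∑ i, boolSign (e i) * w j i| ≤ M e) ∧
      signMean M ≤ 3 / 2 * r * √(l + 2) := by
  set q := √(l + 2)
  have hq : 0 < q := Real.sqrt_pos.2 (by linarith)
  have hq2 : q ^ 2 = l + 2 := Real.sq_sqrt (by linarith)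
  set a := q / r
  have ha : 0 < a := by positivity
  have har : a ^ 2 * r ^ 2 = l + 2 := by rw [← hq2]; simp only [a]; field_simp
  -- `L` is chosen so that the `exp l` exponential moments, each at most `2 exp((l + 2)/2)`, sum to
  -- at most 2 after multiplication by `exp (-L)`. The shift `l + 2` makes `L + 2` exactly `3/2 * q
  -- ^ 2`.
  set L := l + (l + 2) / 2
  refine ⟨fun e => a⁻¹ * (L + ∑ j ∈ J, Real.exp (-L) *
    Real.exp (a * |∑ i, boolSign (e i) * w j i|)), ?_, ?_⟩
  · intro e j hj
    have h1 : Real.exp (-L) * Real.exp (a * |∑ i, boolSign (e i) * w j i|) ≤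
        ∑ j ∈ J, Real.exp (-L) * Real.exp (a * |∑ i, boolSign (e i) * w j i|) :=
      Finset.single_le_sum (f := fun j => Real.exp (-L) *
        Real.exp (a * |∑ i, boolSign (e i) * w j i|)) (fun _ _ => by positivity) hj
    rw [← Real.exp_add] at h1
    -- The inequality `x + 1 ≤ exp x` replaces the logarithm and Jensen's inequality, and yields a
    -- majorant that is explicit for each sign vector.
    have h2 := Real.add_one_le_exp (-L + a * |∑ i, boolSign (e i) * w j i|)
    beta_reduce
    rw [inv_mul_eq_div, le_div_iff₀ ha]
    linarith
  · rw [signMean_const_mul, signMean_add, signMean_const, signMean_sum]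
    have h1 : ∑ j ∈ J, signMean (fun e => Real.exp (-L) *
        Real.exp (a * |∑ i, boolSign (e i) * w j i|)) ≤ 2 := by
      calc _ ≤ ∑ j ∈ J, Real.exp (-L) * (2 * Real.exp ((l + 2) / 2)) := by
            refine Finset.sum_le_sum fun j hj => ?_
            rw [signMean_const_mul, ← har]
            gcongr
            exact signMean_exp_abs_le _ (hw j hj)
        _ = J.card * (2 * Real.exp (-l)) := by
            rw [Finset.sum_const, nsmul_eq_mul]
            have : Real.exp (-L) * Real.exp ((l + 2) / 2) = Real.exp (-l) := by
              rw [← Real.exp_add]; congr 1; simp only [L]; ring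
            rw [← this]; ring
        _ ≤ Real.exp l * (2 * Real.exp (-l)) := by gcongr
        _ = 2 := by
            have : Real.exp l * Real.exp (-l) = 1 := by rw [← Real.exp_add]; simp
            linear_combination 2 * this
    calc _ ≤ a⁻¹ * (L + 2) := by gcongr
      _ = 3 / 2 * r * q := by
        have : L + 2 = 3 / 2 * q ^ 2 := by rw [hq2]; simp only [L]; ring
        rw [this]; simp only [a]; field_simp

/-- By Cauchy–Schwarz. This crude bound controls the distance from a point to the finest net of the
chain; it tends to zero as the net is refined with `n` fixed. -/
lemma abs_sum_boolSign_mul_le (e : Fin n → Bool) (w : Fin n → ℝ) {r : ℝ} (hr : 0 ≤ r)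
    (hw : ∑ i, w i ^ 2 ≤ r ^ 2) : |∑ i, boolSign (e i) * w i| ≤ √n * r := by
  have h := Finset.sum_mul_sq_le_sq_mul_sq Finset.univ (fun i => boolSign (e i)) w
  simp only [boolSign_sq, Finset.sum_const, Finset.card_univ, Fintype.card_fin, nsmul_eq_mul,
    mul_one] at h
  apply abs_le_of_sq_le_sq _ (by positivity)
  rw [mul_pow, Real.sq_sqrt (Nat.cast_nonneg n)]
  exact h.trans (by gcongr)

/-- Chaining along finite nets of dyadic radii. -/
lemma exists_bound_signMean_chain_le {κ : Type*} (w : κ → Fin n → ℝ) (t : ℕ → Finset κ)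
    (l : ℕ → ℝ) {r : ℝ} (hr : 0 < r) (hl : ∀ k, 0 ≤ l k)
    (ht : ∀ k, ((t k).card : ℝ) ≤ Real.exp (l k))
    (hcov : ∀ k f, ∃ g ∈ t k, ∑ i, (w f i - w g i) ^ 2 ≤ (r / 2 ^ (k + 1)) ^ 2)
    (hw : ∀ f, ∑ i, w f i ^ 2 ≤ r ^ 2) (N : ℕ) :
    ∃ M : (Fin n → Bool) → ℝ, (∀ e, ∀ g ∈ t N, |∑ i, boolSign (e i) * w g i| ≤ M e) ∧
      signMean M ≤ 3 * ∑ k ∈ Finset.range (N + 1), r / 2 ^ (k + 1) * √(l k + 2) := by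
  induction N with
  | zero =>
    obtain ⟨M, h1, h2⟩ := exists_bound_signMean_le (t 0) w hr (hl 0) (ht 0) fun j _ => hw j
    refine ⟨M, h1, h2.trans (le_of_eq ?_)⟩
    simp
    ring
  | succ N ih =>
    obtain ⟨M, h1, h2⟩ := ih
    choose p hp hp' using hcov N
    obtain ⟨M', h1', h2'⟩ := exists_bound_signMean_le (t (N + 1)) (fun g i => w g i - w (p g) i)
      (r := r / 2 ^ (N + 1)) (by positivity) (hl (N + 1)) (ht (N + 1)) fun j _ => hp' j
    refine ⟨fun e => M e + M' e, fun e g hg => ?_, ?_⟩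
    · have e1 : ∑ i, boolSign (e i) * w g i = ∑ i, boolSign (e i) * w (p g) i
          + ∑ i, boolSign (e i) * (w g i - w (p g) i) := by
        rw [← Finset.sum_add_distrib]
        exact Finset.sum_congr rfl fun i _ => by ring
      rw [e1]
      exact (abs_add_le _ _).trans (add_le_add (h1 e _ (hp g)) (h1' e g hg))
    · rw [signMean_add, Finset.sum_range_succ, mul_add]
      refine add_le_add h2 (h2'.trans (le_of_eq ?_))
      rw [pow_succ (2 : ℝ) (N + 1)]
      field_simp

/-- Dudley's entropy bound for the mean of the supremum of a Rademacher process. -/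
lemma signMean_iSup_le {κ : Type*} [Nonempty κ] (w : κ → Fin n → ℝ) (t : ℕ → Finset κ)
    (l : ℕ → ℝ) {r b : ℝ} (hr : 0 < r) (hl : ∀ k, 0 ≤ l k)
    (ht : ∀ k, ((t k).card : ℝ) ≤ Real.exp (l k))
    (hcov : ∀ k f, ∃ g ∈ t k, ∑ i, (w f i - w g i) ^ 2 ≤ (r / 2 ^ (k + 1)) ^ 2)
    (hw : ∀ f, ∑ i, w f i ^ 2 ≤ r ^ 2)
    (hb : ∀ N, ∑ k ∈ Finset.range N, r / 2 ^ (k + 1) * √(l k + 2) ≤ b) :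
    signMean (fun e => ⨆ f, |∑ i, boolSign (e i) * w f i|) ≤ 3 * b := by
  have key : ∀ N : ℕ, signMean (fun e => ⨆ f, |∑ i, boolSign (e i) * w f i|)
      ≤ 3 * b + √n * (r / 2 ^ (N + 1)) := by
    intro N
    obtain ⟨M, h1, h2⟩ := exists_bound_signMean_chain_le w t l hr hl ht hcov hw N
    calc _ ≤ signMean (fun e => M e + √n * (r / 2 ^ (N + 1))) := by
          refine signMean_mono fun e => ciSup_le fun f => ?_
          obtain ⟨g, hg, hfg⟩ := hcov N f
          have e1 : ∑ i, boolSign (e i) * w f i = ∑ i, boolSign (e i) * w g i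
              + ∑ i, boolSign (e i) * (w f i - w g i) := by
            rw [← Finset.sum_add_distrib]
            exact Finset.sum_congr rfl fun i _ => by ring
          rw [e1]
          exact (abs_add_le _ _).trans (add_le_add (h1 e g hg)
            (abs_sum_boolSign_mul_le e _ (by positivity) hfg))
      _ ≤ _ := by
          rw [signMean_add, signMean_const]
          have := hb (N + 1)
          linarith
  -- The remainder left by stopping the chain at level `N` disappears in the limit.
  have hlim : Tendsto (fun N : ℕ => 3 * b + √n * (r / 2 ^ (N + 1))) atTop (𝓝 (3 * b)) := by
    have h0 : Tendsto (fun N : ℕ => r * ((1 / 2 : ℝ) ^ (N + 1))) atTop (𝓝 (r * 0)) :=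
      ((tendsto_pow_atTop_nhds_zero_of_lt_one (by norm_num) (by norm_num)).comp
        (tendsto_add_atTop_nat 1)).const_mul r
    have h1 := (h0.const_mul (√n)).const_add (3 * b)
    simp only [mul_zero, add_zero] at h1
    refine h1.congr fun N => ?_
    rw [one_div, inv_pow, div_eq_mul_inv]
  exact ge_of_tendsto' hlim key

end SignMean

/-! ### Entropy functions with controlled dyadic sums -/

/-- A dyadic form of the growth conditions on an entropy bound: `H` is nonnegative, monotone on `[1/2, ∞)`,
bounded below by `h > 0` at `2`, and its dyadic entropy sums are dominated by their first term. -/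
structure DyadicBound (H : ℝ → ℝ) (B h : ℝ) : Prop where
  nonneg : ∀ x, 0 ≤ x → 0 ≤ H x
  mono : MonotoneOn H (Ici (1 / 2))
  pos : 0 < h
  le_two : h ≤ H 2
  sum_le : ∀ x : ℝ, 1 ≤ x → ∀ N : ℕ,
    ∑ k ∈ Finset.range N, √(H (2 ^ k * x)) / 2 ^ k ≤ B * √(H x)

namespace DyadicBound

variable {H : ℝ → ℝ} {B h : ℝ}

lemma le_of_two_le (hH : DyadicBound H B h) {x : ℝ} (hx : 2 ≤ x) : h ≤ H x :=
  hH.le_two.trans (hH.mono (by norm_num) (by simp only [mem_Ici]; linarith) hx)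

lemma one_le (hH : DyadicBound H B h) : 1 ≤ B := by
  have h1 := hH.sum_le 2 (by norm_num) 1
  simp only [Finset.sum_range_one, pow_zero, one_mul, div_one] at h1
  have h2 : 0 < √(H 2) := Real.sqrt_pos.2 (hH.pos.trans_le hH.le_two)
  by_contra! hB
  nlinarith

/-- A single term of the dyadic sum is at most the whole sum, so `√H` grows at most linearly along
powers of 2; rounding `l` up to a power of 2 costs the factor 2. -/
lemma sqrt_mul_le (hH : DyadicBound H B h) {x l : ℝ} (hx : 1 ≤ x) (hl : 1 ≤ l) :
    √(H (l * x)) ≤ 2 * B * l * √(H x) := by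
  obtain ⟨k, hk1, hk2⟩ := exists_nat_pow_near hl (by norm_num : (1 : ℝ) < 2)
  have h1 : √(H (2 ^ (k + 1) * x)) / 2 ^ (k + 1) ≤ B * √(H x) :=
    (Finset.single_le_sum (f := fun k : ℕ => √(H (2 ^ k * x)) / 2 ^ k)
      (fun _ _ => by positivity) (Finset.self_mem_range_succ (k + 1))).trans
      (hH.sum_le x hx (k + 1 + 1))
  have h2 : H (l * x) ≤ H (2 ^ (k + 1) * x) := by
    refine hH.mono ?_ ?_ (by gcongr)
    · simp only [mem_Ici]; nlinarith
    · have : (1 : ℝ) ≤ 2 ^ (k + 1) := one_le_pow₀ (by norm_num)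
      simp only [mem_Ici]; nlinarith
  rw [div_le_iff₀ (by positivity)] at h1
  have hB := hH.one_le
  calc √(H (l * x)) ≤ B * √(H x) * 2 ^ (k + 1) := (Real.sqrt_le_sqrt h2).trans h1
    _ = B * √(H x) * (2 * 2 ^ k) := by rw [pow_succ]; ring
    _ ≤ B * √(H x) * (2 * l) := by gcongr
    _ = _ := by ring

/-- The function `(s, t) ↦ s √(H (2 t / s))` is dominated by a linear function. -/
lemma mul_sqrt_le (hH : DyadicBound H B h) {s t x : ℝ} (hs : 0 < s) (hst : s ≤ t)
    (hx : 1 ≤ x) :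
    s * √(H (2 * t / s)) ≤ 2 * B * √(H (2 * x)) * (s + t / x) := by
  have hB := hH.one_le
  have ht : 0 < t := hs.trans_le hst
  have h1 : 1 ≤ t / s := (one_le_div hs).2 hst
  rcases le_total (t / s) x with hc | hc
  · have h2 : H (2 * t / s) ≤ H (2 * x) := by
      rw [mul_div_assoc]
      refine hH.mono ?_ ?_ (by gcongr) <;> simp only [mem_Ici] <;> linarith
    calc s * √(H (2 * t / s)) ≤ s * √(H (2 * x)) := by gcongr
      _ = 1 * √(H (2 * x)) * s := by ring
      _ ≤ 2 * B * √(H (2 * x)) * (s + t / x) := by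
        have : 0 ≤ t / x := by positivity
        gcongr <;> linarith
  · have h2 := hH.sqrt_mul_le (x := 2 * x) (l := t / s / x) (by linarith)
      ((one_le_div (by linarith)).2 hc)
    have e : t / s / x * (2 * x) = 2 * t / s := by field_simp
    rw [e] at h2
    calc s * √(H (2 * t / s)) ≤ s * (2 * B * (t / s / x) * √(H (2 * x))) := by gcongr
      _ = 2 * B * √(H (2 * x)) * (t / x) := by field_simp
      _ ≤ 2 * B * √(H (2 * x)) * (s + t / x) := by gcongr; linarith

/-- The constant in the entropy bound for Rademacher processes. -/
noncomputable def chainConst (B h : ℝ) : ℝ := 3 / 2 * B * √(1 + 2 / h)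

lemma chainConst_pos (hH : DyadicBound H B h) : 0 < chainConst B h := by
  have := hH.one_le
  have := hH.pos
  unfold chainConst
  positivity

/-- Entropy bound for the mean of the supremum of a Rademacher process. -/
lemma signMean_iSup_le (hH : DyadicBound H B h) {n : ℕ} (hn : 1 ≤ n) {κ : Type*} [Nonempty κ]
    (w : κ → Fin n → ℝ) {s t : ℝ} (hs : 0 < s) (hst : s ≤ t)
    (hw : ∀ f, ∑ i, w f i ^ 2 ≤ n * s ^ 2)
    (hcov : ∀ τ : ℝ, 0 < τ → ∃ T : Finset κ, (T.card : ℝ) ≤ Real.exp (H (t / τ)) ∧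
      ∀ f, ∃ g ∈ T, ∑ i, (w f i - w g i) ^ 2 ≤ n * τ ^ 2) :
    signMean (fun e => ⨆ f, |∑ i, boolSign (e i) * w f i|)
      ≤ chainConst B h * √n * (s * √(H (2 * t / s))) := by
  have hn0 : (0 : ℝ) < n := by exact_mod_cast hn
  have hh := hH.pos
  have hB := hH.one_le
  have hts : 1 ≤ t / s := (one_le_div hs).2 hst
  choose T hT hTc using fun k : ℕ => hcov (s / 2 ^ (k + 1)) (by positivity)
  have earg : ∀ k : ℕ, t / (s / 2 ^ (k + 1)) = 2 ^ k * (2 * t / s) := by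
    intro k; rw [pow_succ]; field_simp
  have hHk : ∀ k : ℕ, h ≤ H (2 ^ k * (2 * t / s)) := by
    intro k
    apply hH.le_of_two_le
    have : (1 : ℝ) ≤ 2 ^ k := one_le_pow₀ (by norm_num)
    rw [mul_div_assoc]
    nlinarith
  have key := EmpiricalEntropy.signMean_iSup_le w T (fun k => H (2 ^ k * (2 * t / s)))
    (r := √n * s) (b := √n * s / 2 * √(1 + 2 / h) * (B * √(H (2 * t / s))))
    (by positivity) (fun k => hh.le.trans (hHk k)) (fun k => by rw [← earg]; exact hT k)
    (fun k f => ?_) (fun f => ?_) (fun N => ?_)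
  · refine key.trans (le_of_eq ?_)
    unfold chainConst
    ring
  · obtain ⟨g, hg, hfg⟩ := hTc k f
    refine ⟨g, hg, hfg.trans (le_of_eq ?_)⟩
    rw [div_pow, div_pow, mul_pow, Real.sq_sqrt hn0.le]
    ring
  · rw [mul_pow, Real.sq_sqrt hn0.le]
    exact hw f
  · calc ∑ k ∈ Finset.range N, √n * s / 2 ^ (k + 1) * √(H (2 ^ k * (2 * t / s)) + 2)
        ≤ ∑ k ∈ Finset.range N, √n * s / 2 * √(1 + 2 / h) *
            (√(H (2 ^ k * (2 * t / s))) / 2 ^ k) := by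
          refine Finset.sum_le_sum fun k _ => ?_
          -- The extra 2 from the maximal inequality is absorbed since `H ≥ h` at these arguments;
          -- this is where a lower bound for `H 2` is needed.
          have h1 : √(H (2 ^ k * (2 * t / s)) + 2)
              ≤ √(1 + 2 / h) * √(H (2 ^ k * (2 * t / s))) := by
            rw [← Real.sqrt_mul (by positivity)]
            apply Real.sqrt_le_sqrt
            have h2 : 1 ≤ H (2 ^ k * (2 * t / s)) / h := (one_le_div hh).2 (hHk k)
            have h3 : (1 + 2 / h) * H (2 ^ k * (2 * t / s))
              = H (2 ^ k * (2 * t / s)) + 2 * (H (2 ^ k * (2 * t / s)) / h) := by ring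
            linarith
          calc _ ≤ √n * s / 2 ^ (k + 1) * (√(1 + 2 / h) * √(H (2 ^ k * (2 * t / s)))) := by
                gcongr
            _ = _ := by rw [pow_succ]; field_simp
      _ ≤ _ := by
          rw [← Finset.mul_sum]
          gcongr
          apply hH.sum_le
          rw [mul_div_assoc]
          linarith

end DyadicBound

/-- A finite covering number is attained by an actual net, since an infimum of extended naturals
lying strictly below its successor is reached by some competitor. -/
lemma exists_finset_cover_of_entropy_le {S : Type*} [MeasurableSpace S] {𝓕 : Set (S → ℝ)}
    {Q : Measure S} {τ y : ℝ} (hy : entropy 𝓕 Q τ ≤ (y : EReal)) :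
    ∃ T : Finset 𝓕, (T.card : ℝ) ≤ Real.exp y ∧
      ∀ f : 𝓕, ∃ g ∈ T, l2norm Q (f.1 - g.1) < τ := by
  have h1 : ((coveringNumber 𝓕 Q τ : ℕ∞) : ENNReal) ≤ ENNReal.ofReal (Real.exp y) := by
    unfold entropy at hy
    rw [← EReal.log_exp (y : EReal), ENNReal.log_le_log_iff] at hy
    simpa using hy
  have h2 : coveringNumber 𝓕 Q τ ≠ ⊤ := by
    intro h
    rw [h] at h1
    simp at h1
  have h3 : coveringNumber 𝓕 Q τ < coveringNumber 𝓕 Q τ + 1 :=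
    ENat.lt_add_one_iff h2 |>.2 le_rfl
  conv_lhs at h3 => unfold coveringNumber
  simp only [iInf_lt_iff] at h3
  obtain ⟨t, ht, hc, hlt⟩ := h3
  have hle : t.encard ≤ coveringNumber 𝓕 Q τ := (ENat.lt_add_one_iff h2).1 hlt
  have hfin : t.Finite := by
    rw [← Set.encard_ne_top_iff]
    exact ne_top_of_le_ne_top h2 hle
  have hfin' : ((↑) ⁻¹' t : Set 𝓕).Finite := hfin.preimage Subtype.val_injective.injOn
  refine ⟨hfin'.toFinset, ?_, fun f => ?_⟩
  · have h4 : ((hfin'.toFinset.card : ℕ∞)) ≤ t.encard := by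
      rw [← Set.Finite.encard_eq_coe_toFinset_card hfin']
      exact Set.encard_preimage_val_le_encard_right 𝓕 t
    have h5 : ((hfin'.toFinset.card : ℕ∞) : ENNReal) ≤ ENNReal.ofReal (Real.exp y) :=
      (ENat.toENNReal_le.2 (h4.trans hle)).trans h1
    have h6 := ENNReal.toReal_mono ENNReal.ofReal_ne_top h5
    rwa [ENNReal.toReal_ofReal (Real.exp_pos y).le, ENat.toENNReal_coe,
      ENNReal.toReal_natCast] at h6
  · obtain ⟨g, hg, hfg⟩ := hc f f.2
    exact ⟨⟨g, ht hg⟩, by simpa using hg, hfg⟩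

/-! ### Symmetrization with an independent copy -/

section Symmetrization

variable {S : Type*} {n : ℕ}

/-- The vector whose `i`-th coordinate is taken from `x` or from `y`, according to `e i`. -/
def mixVec (e : Fin n → Bool) (x y : Fin n → S) (i : Fin n) : S := if e i then x i else y i

/-- Exchanging the coordinates of `x` and `y` where the sign is `-1` turns a difference of sums into
a difference of signed sums. The exchange preserves the product law, so symmetrization holds for
each fixed sign vector. -/
lemma sum_sub_eq_mixVec (e : Fin n → Bool) (g : S → ℝ) (x y : Fin n → S) :
    ∑ i, g (x i) - ∑ i, g (y i)
      = ∑ i, boolSign (e i) * g (mixVec e x y i) - ∑ i, boolSign (e i) * g (mixVec e y x i) := by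
  rw [← Finset.sum_sub_distrib, ← Finset.sum_sub_distrib]
  refine Finset.sum_congr rfl fun i _ => ?_
  cases h : e i
  · simp [boolSign, mixVec, h]
    ring
  · simp [boolSign, mixVec, h]

/-- The supremum of a Rademacher process indexed by a family of functions. -/
noncomputable def signSup {κ : Type*} (g : κ → S → ℝ) (e : Fin n → Bool) (x : Fin n → S) : ℝ :=
  ⨆ f, |∑ i, boolSign (e i) * g f (x i)|

lemma abs_sum_boolSign_le (e : Fin n → Bool) {g : S → ℝ} (hg : ∀ x, |g x| ≤ 1)
    (x : Fin n → S) : |∑ i, boolSign (e i) * g (x i)| ≤ n := by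
  calc _ ≤ ∑ i, |boolSign (e i) * g (x i)| := Finset.abs_sum_le_sum_abs _ _
    _ ≤ ∑ _i : Fin n, (1 : ℝ) := by
      refine Finset.sum_le_sum fun i _ => ?_
      rw [abs_mul, abs_boolSign, one_mul]
      exact hg _
    _ = n := by simp

lemma bddAbove_signSup {κ : Type*} {g : κ → S → ℝ} (hg : ∀ f x, |g f x| ≤ 1)
    (e : Fin n → Bool) (x : Fin n → S) :
    BddAbove (range fun f => |∑ i, boolSign (e i) * g f (x i)|) :=
  ⟨n, by rintro _ ⟨f, rfl⟩; exact abs_sum_boolSign_le e (hg f) x⟩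

lemma signSup_nonneg {κ : Type*} (g : κ → S → ℝ) (e : Fin n → Bool) (x : Fin n → S) :
    0 ≤ signSup g e x := Real.iSup_nonneg fun _ => abs_nonneg _

lemma signSup_le {κ : Type*} [Nonempty κ] {g : κ → S → ℝ} (hg : ∀ f x, |g f x| ≤ 1)
    (e : Fin n → Bool) (x : Fin n → S) : signSup g e x ≤ n :=
  ciSup_le fun f => abs_sum_boolSign_le e (hg f) x

variable [MeasurableSpace S] (P : Measure S) [IsProbabilityMeasure P]

lemma measurable_mixVec (e : Fin n → Bool) :
    Measurable fun p : (Fin n → S) × (Fin n → S) => mixVec e p.1 p.2 := by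
  refine measurable_pi_lambda _ fun i => ?_
  cases h : e i <;> simp only [mixVec, h] <;> simp <;> fun_prop

lemma measurePreserving_mixVec (e : Fin n → Bool) :
    MeasurePreserving (fun p : (Fin n → S) × (Fin n → S) => mixVec e p.1 p.2)
      ((Measure.pi fun _ => P).prod (Measure.pi fun _ => P)) (Measure.pi fun _ => P) := by
  refine ⟨measurable_mixVec e, (Measure.pi_eq fun s hs => ?_).symm⟩
  rw [Measure.map_apply (measurable_mixVec e) (MeasurableSet.univ_pi hs)]
  have hpre : (fun p : (Fin n → S) × (Fin n → S) => mixVec e p.1 p.2) ⁻¹' (univ.pi s)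
      = (univ.pi fun i => if e i then s i else univ) ×ˢ
        (univ.pi fun i => if e i then univ else s i) := by
    ext p
    simp only [mem_preimage, Set.mem_pi, mem_univ, true_imp_iff, mem_prod, mixVec, ← forall_and]
    refine forall_congr' fun i => ?_
    cases e i <;> simp
  rw [hpre, Measure.prod_prod, Measure.pi_pi, Measure.pi_pi, ← Finset.prod_mul_distrib]
  refine Finset.prod_congr rfl fun i _ => ?_
  cases e i <;> simp

lemma measurePreserving_mixVec_swap (e : Fin n → Bool) :
    MeasurePreserving (fun p : (Fin n → S) × (Fin n → S) => mixVec e p.2 p.1)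
      ((Measure.pi fun _ => P).prod (Measure.pi fun _ => P)) (Measure.pi fun _ => P) :=
  (measurePreserving_mixVec P e).comp Measure.measurePreserving_swap

/-- Symmetrization for a fixed choice of signs: the centered process has a majorant whose mean is
at most twice the mean of the signed process. -/
lemma exists_majorant_of_signSup {κ : Type*} {g : κ → S → ℝ}
    (hgm : ∀ f, Measurable (g f)) (hg : ∀ f x, |g f x| ≤ 1) (e : Fin n → Bool)
    (hM : AEMeasurable (signSup g e) (Measure.pi fun _ : Fin n => P)) :
    ∃ T : (Fin n → S) → ENNReal,
      (∀ x f, ENNReal.ofReal |∑ i, g f (x i) - n * ∫ y, g f y ∂P| ≤ T x) ∧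
      ∫⁻ x, T x ∂(Measure.pi fun _ : Fin n => P)
        ≤ 2 * ∫⁻ x, ENNReal.ofReal (signSup g e x) ∂(Measure.pi fun _ : Fin n => P) := by
  set Q := Measure.pi fun _ : Fin n => P
  have hA := (hM.comp_quasiMeasurePreserving
    (measurePreserving_mixVec P e).quasiMeasurePreserving).ennreal_ofReal
  have hA' := (hM.comp_quasiMeasurePreserving
    (measurePreserving_mixVec_swap P e).quasiMeasurePreserving).ennreal_ofReal
  -- The second sample is integrated out. The bound holds at every `x` and for all `f` at once, so
  -- the supremum of the centered process need not be measurable.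
  refine ⟨fun x => ∫⁻ y, (ENNReal.ofReal (signSup g e (mixVec e x y))
    + ENNReal.ofReal (signSup g e (mixVec e y x))) ∂Q, fun x f => ?_, ?_⟩
  · have hint : ∀ i : Fin n, Integrable (fun y : Fin n → S => g f (y i)) Q := fun i =>
      Integrable.of_bound (((hgm f).comp (measurable_pi_apply i)).aestronglyMeasurable) 1
        (ae_of_all _ fun y => hg f _)
    have hsum : ∫ y, ∑ i, g f (y i) ∂Q = n * ∫ y, g f y ∂P := by
      rw [integral_finsetSum _ fun i _ => hint i]
      have : ∀ i : Fin n, ∫ y, g f (y i) ∂Q = ∫ y, g f y ∂P := fun i =>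
        integral_comp_eval (μ := fun _ : Fin n => P) (hgm f).aestronglyMeasurable
      simp [this]
    have h1 : ∑ i, g f (x i) - n * ∫ y, g f y ∂P
        = ∫ y, (∑ i, g f (x i) - ∑ i, g f (y i)) ∂Q := by
      rw [integral_sub (integrable_const _) (integrable_finsetSum _ fun i _ => hint i), hsum]
      simp
    rw [h1, ← Real.norm_eq_abs, ofReal_norm]
    refine (enorm_integral_le_lintegral_enorm _).trans (lintegral_mono fun y => ?_)
    rw [sum_sub_eq_mixVec e, ← ofReal_norm, Real.norm_eq_abs,
      ← ENNReal.ofReal_add (signSup_nonneg _ _ _) (signSup_nonneg _ _ _)]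
    refine ENNReal.ofReal_le_ofReal ((abs_sub _ _).trans (add_le_add ?_ ?_))
    · exact le_ciSup (bddAbove_signSup hg e (mixVec e x y)) f
    · exact le_ciSup (bddAbove_signSup hg e (mixVec e y x)) f
  · have h1 := lintegral_prod _ (hA.add hA')
    refine le_of_eq ?_
    refine h1.symm.trans ?_
    have h2 : ∀ {φ : (Fin n → S) × (Fin n → S) → (Fin n → S)},
        MeasurePreserving φ (Q.prod Q) Q →
        ∫⁻ p, ENNReal.ofReal (signSup g e (φ p)) ∂(Q.prod Q)
          = ∫⁻ x, ENNReal.ofReal (signSup g e x) ∂Q := by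
      intro φ hφ
      have hM' : AEMeasurable (fun x => ENNReal.ofReal (signSup g e x)) ((Q.prod Q).map φ) := by
        rw [hφ.map_eq]; exact hM.ennreal_ofReal
      rw [← lintegral_map' hM' hφ.aemeasurable, hφ.map_eq]
    have h3 := lintegral_add_left' hA
      fun p => ENNReal.ofReal (signSup g e (mixVec e p.2 p.1))
    refine h3.trans ?_
    rw [two_mul]
    exact congrArg₂ (· + ·) (h2 (measurePreserving_mixVec P e))
      (h2 (measurePreserving_mixVec_swap P e))

lemma integrable_signSup {κ : Type*} [Nonempty κ] {g : κ → S → ℝ} (hg : ∀ f x, |g f x| ≤ 1)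
    (e : Fin n → Bool) (hM : AEMeasurable (signSup g e) (Measure.pi fun _ : Fin n => P)) :
    Integrable (signSup g e) (Measure.pi fun _ : Fin n => P) :=
  Integrable.of_bound hM.aestronglyMeasurable n (ae_of_all _ fun x => by
    rw [Real.norm_eq_abs, abs_of_nonneg (signSup_nonneg _ _ _)]
    exact signSup_le hg e x)

/-- The quantity `Z` enters only through bounds `b` of the centered process, so the same statement
serves for the supremum of the sums (`c = 0`) and for `n/2` times the largest second moment (`c = n
σ² / 2`). -/
lemma integral_le_add_two_mul_signSup {κ : Type*} [Nonempty κ] {g : κ → S → ℝ}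
    (hgm : ∀ f, Measurable (g f)) (hg : ∀ f x, |g f x| ≤ 1) (e : Fin n → Bool)
    (hM : AEMeasurable (signSup g e) (Measure.pi fun _ : Fin n => P))
    {Z : (Fin n → S) → ℝ} (hZ : AEMeasurable Z (Measure.pi fun _ : Fin n => P))
    (hZ0 : ∀ x, 0 ≤ Z x) {c : ℝ} (hc : 0 ≤ c)
    (hZc : ∀ x b, (∀ f, |∑ i, g f (x i) - n * ∫ y, g f y ∂P| ≤ b) → Z x ≤ c + b) :
    ∫ x, Z x ∂(Measure.pi fun _ : Fin n => P)
      ≤ c + 2 * ∫ x, signSup g e x ∂(Measure.pi fun _ : Fin n => P) := by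
  set Q := Measure.pi fun _ : Fin n => P
  obtain ⟨T, hT, hTint⟩ := exists_majorant_of_signSup P hgm hg e hM
  have hMi := integrable_signSup P hg e hM
  rw [integral_eq_lintegral_of_nonneg_ae (ae_of_all _ hZ0) hZ.aestronglyMeasurable]
  have h1 : ∫⁻ x, ENNReal.ofReal (Z x) ∂Q ≤ ∫⁻ x, (ENNReal.ofReal c + T x) ∂Q := by
    refine lintegral_mono fun x => ?_
    -- The majorant may be infinite at some points, where there is nothing to prove; elsewhere its
    -- real value is an admissible `b`.
    by_cases hx : T x = ⊤
    · simp [hx]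
    · have := hZc x (T x).toReal fun f => by
        have h := ENNReal.toReal_mono hx (hT x f)
        rwa [ENNReal.toReal_ofReal (abs_nonneg _)] at h
      calc ENNReal.ofReal (Z x) ≤ ENNReal.ofReal (c + (T x).toReal) :=
            ENNReal.ofReal_le_ofReal this
        _ = _ := by rw [ENNReal.ofReal_add hc ENNReal.toReal_nonneg, ENNReal.ofReal_toReal hx]
  have h2 : ∫⁻ x, ENNReal.ofReal (Z x) ∂Q
      ≤ ENNReal.ofReal (c + 2 * ∫ x, signSup g e x ∂Q) := by
    refine h1.trans ?_
    rw [lintegral_add_left measurable_const, lintegral_const, measure_univ, mul_one,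
      ENNReal.ofReal_add hc (mul_nonneg zero_le_two
        (integral_nonneg fun x => signSup_nonneg _ _ _)),
      ENNReal.ofReal_mul zero_le_two,
      ofReal_integral_eq_lintegral_ofReal hMi (ae_of_all _ fun x => signSup_nonneg _ _ _)]
    gcongr
    simpa using hTint
  exact ENNReal.toReal_le_of_le_ofReal (add_nonneg hc (mul_nonneg zero_le_two
    (integral_nonneg fun x => signSup_nonneg _ _ _))) h2

/-- Symmetrization: the mean of a function controlled by the centered process is bounded by any
bound of the averaged Rademacher process. -/
lemma integral_le_add_two_mul {κ : Type*} [Nonempty κ] {g : κ → S → ℝ}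
    (hgm : ∀ f, Measurable (g f)) (hg : ∀ f x, |g f x| ≤ 1)
    (hM : ∀ e : Fin n → Bool, AEMeasurable (signSup g e) (Measure.pi fun _ : Fin n => P))
    {Z : (Fin n → S) → ℝ} (hZ : AEMeasurable Z (Measure.pi fun _ : Fin n => P))
    (hZ0 : ∀ x, 0 ≤ Z x) {c : ℝ} (hc : 0 ≤ c)
    (hZc : ∀ x b, (∀ f, |∑ i, g f (x i) - n * ∫ y, g f y ∂P| ≤ b) → Z x ≤ c + b) :
    ∫ x, Z x ∂(Measure.pi fun _ : Fin n => P)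
      ≤ c + 2 * ∫ x, signMean (fun e => signSup g e x) ∂(Measure.pi fun _ : Fin n => P) := by
  have h1 : ∫ x, signMean (fun e => signSup g e x) ∂(Measure.pi fun _ : Fin n => P)
      = signMean fun e => ∫ x, signSup g e x ∂(Measure.pi fun _ : Fin n => P) := by
    unfold signMean
    rw [integral_div, integral_finsetSum _ fun e _ => integrable_signSup P hg e (hM e)]
  rw [h1, ← signMean_const_mul, ← signMean_const (n := n) c, ← signMean_add,
    ← signMean_const (n := n) (∫ x, Z x ∂(Measure.pi fun _ : Fin n => P))]
  exact signMean_mono fun e => by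
    simpa [signMean_const] using integral_le_add_two_mul_signSup P hgm hg e (hM e) hZ hZ0 hc hZc

lemma integrable_signMean_signSup {κ : Type*} [Nonempty κ] {g : κ → S → ℝ}
    (hg : ∀ f x, |g f x| ≤ 1)
    (hM : ∀ e : Fin n → Bool, AEMeasurable (signSup g e) (Measure.pi fun _ : Fin n => P)) :
    Integrable (fun x => signMean fun e => signSup g e x) (Measure.pi fun _ : Fin n => P) := by
  unfold signMean
  exact (integrable_finsetSum _ fun e _ => integrable_signSup P hg e (hM e)).div_const _

end Symmetrization

/-! ### Empirical second moments -/

section Moments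

variable {S : Type*}

/-- The largest empirical second moment `sup_{f ∈ 𝓕} Pₙ f²`. -/
noncomputable def maxSecondMoment (𝓕 : Set (S → ℝ)) {n : ℕ} (x : Fin n → S) : ℝ :=
  supNorm 𝓕 fun f => ∑ i, 1 / (n : ℝ) * f (x i) ^ 2

/-- The empirical second moment of a function. -/
noncomputable def secondMoment (F : S → ℝ) {n : ℕ} (x : Fin n → S) : ℝ :=
  ∑ i, 1 / (n : ℝ) * F (x i) ^ 2

lemma maxSecondMoment_nonneg (𝓕 : Set (S → ℝ)) {n : ℕ} (x : Fin n → S) :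
    0 ≤ maxSecondMoment 𝓕 x := Real.iSup_nonneg fun _ => abs_nonneg _

lemma secondMoment_nonneg (F : S → ℝ) {n : ℕ} (x : Fin n → S) : 0 ≤ secondMoment F x :=
  Finset.sum_nonneg fun _ _ => by positivity

end Moments

/-! ### The empirical process and its second moments at a given scale -/

section Empirical

variable {S : Type*} [MeasurableSpace S]

lemma l2norm_sq (P : Measure S) (F : S → ℝ) : l2norm P F ^ 2 = ∫ x, F x ^ 2 ∂P :=
  Real.sq_sqrt (integral_nonneg fun _ => sq_nonneg _)

lemma integral_empiricalMeasure {n : ℕ} {g : S → ℝ} (hg : Measurable g) (x : ℕ → S) :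
    ∫ y, g y ∂(empiricalMeasure n x) = ∑ i : Fin n, 1 / (n : ℝ) * g (x i) := by
  unfold empiricalMeasure
  rw [integral_smul_measure, integral_finsetSum_measure, Finset.sum_range, smul_eq_mul,
    Finset.mul_sum]
  · refine Finset.sum_congr rfl fun i _ => ?_
    rw [integral_dirac' _ _ hg.stronglyMeasurable]
    simp
  · intro i _
    exact integrable_dirac' hg.stronglyMeasurable (by simp)

lemma l2norm_empiricalMeasure {n : ℕ} {g : S → ℝ} (hg : Measurable g) (x : ℕ → S) :
    l2norm (empiricalMeasure n x) g = √(∑ i : Fin n, 1 / (n : ℝ) * g (x i) ^ 2) := by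
  rw [l2norm, integral_empiricalMeasure (hg.pow_const 2)]

lemma map_sample_eq {Ω : Type*} [MeasurableSpace Ω] {μ : Measure Ω} [IsProbabilityMeasure μ]
    {P : Measure S} {X : ℕ → Ω → S} (hX : IsSample μ P X) (n : ℕ) :
    μ.map (fun ω (i : Fin n) => X i ω) = Measure.pi fun _ : Fin n => P := by
  have h1 : iIndepFun (fun i : Fin n => X i) μ :=
    hX.indep.precomp (g := fun i : Fin n => (i : ℕ)) Fin.val_injective
  have h2 := (iIndepFun_iff_map_fun_eq_pi_map
    fun i : Fin n => (hX.measurable i).aemeasurable).1 h1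
  simpa only [hX.map_eq] using h2

lemma measurable_sample {Ω : Type*} [MeasurableSpace Ω] {μ : Measure Ω}
    {P : Measure S} {X : ℕ → Ω → S} (hX : IsSample μ P X) (n : ℕ) :
    Measurable (fun ω (i : Fin n) => X i ω) :=
  measurable_pi_lambda _ fun i => hX.measurable i

variable {P : Measure S} {𝓕 : Set (S → ℝ)} {F : S → ℝ} {σ : ℝ} {n : ℕ}

namespace IsCenteredClass

lemma abs_le_one (h : IsCenteredClass P 𝓕 F σ) {f : S → ℝ} (hf : f ∈ 𝓕) (x : S) : |f x| ≤ 1 :=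
  (h.abs_le_envelope f hf x).trans (h.envelope_le_one x)

lemma envelope_nonneg (h : IsCenteredClass P 𝓕 F σ) (hne : 𝓕.Nonempty) (x : S) : 0 ≤ F x := by
  obtain ⟨f, hf⟩ := hne
  exact (abs_nonneg _).trans (h.abs_le_envelope f hf x)

lemma secondMoment_le (h : IsCenteredClass P 𝓕 F σ) {f : S → ℝ} (hf : f ∈ 𝓕) (x : Fin n → S) :
    secondMoment f x ≤ secondMoment F x := by
  unfold secondMoment
  refine Finset.sum_le_sum fun i _ => ?_
  have := h.abs_le_envelope f hf (x i)
  have : f (x i) ^ 2 ≤ F (x i) ^ 2 := sq_le_sq' (by linarith [neg_abs_le (f (x i))])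
    ((le_abs_self _).trans this)
  gcongr

lemma secondMoment_le_max (h : IsCenteredClass P 𝓕 F σ) {f : S → ℝ} (hf : f ∈ 𝓕)
    (x : Fin n → S) : secondMoment f x ≤ maxSecondMoment 𝓕 x := by
  refine (le_abs_self _).trans (le_ciSup (f := fun f : 𝓕 => |secondMoment f.1 x|)
    ⟨secondMoment F x, ?_⟩ ⟨f, hf⟩)
  rintro _ ⟨g, rfl⟩
  beta_reduce
  rw [abs_of_nonneg (secondMoment_nonneg _ _)]
  exact h.secondMoment_le g.2 x

lemma maxSecondMoment_le (h : IsCenteredClass P 𝓕 F σ) (x : Fin n → S) :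
    maxSecondMoment 𝓕 x ≤ secondMoment F x := by
  refine Real.iSup_le (fun f => ?_) (secondMoment_nonneg _ _)
  change |secondMoment f.1 x| ≤ _
  rw [abs_of_nonneg (secondMoment_nonneg _ _)]
  exact h.secondMoment_le f.2 x

lemma aemeasurable_maxSecondMoment (h : IsCenteredClass P 𝓕 F σ) :
    AEMeasurable (maxSecondMoment 𝓕) (Measure.pi fun _ : Fin n => P) :=
  (h.suitablyMeasurable n fun _ => 1 / n).2

lemma l2norm_pos (h : IsCenteredClass P 𝓕 F σ) : 0 < l2norm P F := by
  have h1 : 0 < l2norm P F ^ 2 := (pow_pos h.sigma_pos 2).trans_le h.sigma_le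
  have h2 : 0 ≤ l2norm P F := Real.sqrt_nonneg _
  exact h2.lt_of_ne fun h3 => by simp [← h3] at h1

variable [IsProbabilityMeasure P]

lemma integrable_envelope_sq (h : IsCenteredClass P 𝓕 F σ) (hne : 𝓕.Nonempty) :
    Integrable (fun x => F x ^ 2) P :=
  Integrable.of_bound (h.envelope_measurable.pow_const 2).aestronglyMeasurable 1
    (ae_of_all _ fun x => by
      rw [Real.norm_eq_abs, abs_of_nonneg (sq_nonneg _)]
      exact pow_le_one₀ (h.envelope_nonneg hne x) (h.envelope_le_one x))

lemma integrable_secondMoment (h : IsCenteredClass P 𝓕 F σ) (hne : 𝓕.Nonempty) :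
    Integrable (secondMoment F) (Measure.pi fun _ : Fin n => P) := by
  unfold secondMoment
  exact integrable_finsetSum _ fun i _ =>
    (integrable_comp_eval (μ := fun _ : Fin n => P) (i := i)
      (h.integrable_envelope_sq hne)).const_mul _

lemma integral_secondMoment (h : IsCenteredClass P 𝓕 F σ) (hne : 𝓕.Nonempty) (hn : 1 ≤ n) :
    ∫ x, secondMoment F x ∂(Measure.pi fun _ : Fin n => P) = l2norm P F ^ 2 := by
  have hn0 : (n : ℝ) ≠ 0 := by positivity
  unfold secondMoment
  rw [l2norm_sq, integral_finsetSum _ fun i _ =>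
    (integrable_comp_eval (μ := fun _ : Fin n => P) (i := i)
      (h.integrable_envelope_sq hne)).const_mul _]
  have : ∀ i : Fin n, ∫ x : Fin n → S, 1 / (n : ℝ) * F (x i) ^ 2 ∂(Measure.pi fun _ => P)
      = 1 / (n : ℝ) * ∫ y, F y ^ 2 ∂P := fun i => by
    rw [integral_const_mul]
    congr 1
    exact integral_comp_eval (μ := fun _ : Fin n => P) (i := i)
      (f := fun y => F y ^ 2) (h.envelope_measurable.pow_const 2).aestronglyMeasurable
  simp only [this, Finset.sum_const, Finset.card_univ, Fintype.card_fin, nsmul_eq_mul]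
  field_simp

lemma integrable_maxSecondMoment (h : IsCenteredClass P 𝓕 F σ) (hne : 𝓕.Nonempty) :
    Integrable (maxSecondMoment 𝓕) (Measure.pi fun _ : Fin n => P) :=
  (h.integrable_secondMoment hne).mono' h.aemeasurable_maxSecondMoment.aestronglyMeasurable
    (ae_of_all _ fun x => by
      rw [Real.norm_eq_abs, abs_of_nonneg (maxSecondMoment_nonneg _ _)]
      exact h.maxSecondMoment_le x)

end IsCenteredClass

/-- A `1`-Lipschitz transformation of `[-1, 1]` fixing `0`. -/
structure IsContractionMap (φ : ℝ → ℝ) : Prop where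
  zero : φ 0 = 0
  abs_sub_le : ∀ a b, |a| ≤ 1 → |b| ≤ 1 → |φ a - φ b| ≤ |a - b|

lemma IsContractionMap.abs_le {φ : ℝ → ℝ} (hφ : IsContractionMap φ) {a : ℝ} (ha : |a| ≤ 1) :
    |φ a| ≤ |a| := by
  simpa [hφ.zero] using hφ.abs_sub_le a 0 ha (by simp)

variable {Ω : Type*} {X : ℕ → Ω → S} {H : ℝ → ℝ} {B h₀ : ℝ}

/-- Entropy bound for the Rademacher process, conditionally on the sample. -/
lemma signMean_signSup_le (hH : DyadicBound H B h₀) (hF : IsCenteredClass P 𝓕 F σ)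
    (hne : 𝓕.Nonempty) (hE : EntropyCondition X 𝓕 F H) (hn : 1 ≤ n) (ω : Ω)
    {φ : ℝ → ℝ} (hφ : IsContractionMap φ) {z : ℝ} (hz : 1 ≤ z) :
    signMean (fun e => signSup (fun (f : 𝓕) x => φ (f.1 x)) e fun i : Fin n => X i ω)
      ≤ DyadicBound.chainConst B h₀ * √n * (2 * B * √(H (2 * z)) *
        (√(maxSecondMoment 𝓕 fun i : Fin n => X i ω)
          + √(secondMoment F fun i : Fin n => X i ω) / z)) := by
  have hn0 : (0 : ℝ) < n := by exact_mod_cast hn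
  set x : Fin n → S := fun i => X i ω
  have : Nonempty 𝓕 := hne.to_subtype
  have hκ := hH.chainConst_pos
  have hB := hH.one_le
  have hsum : ∀ f : S → ℝ, ∑ i, f (x i) ^ 2 = n * secondMoment f x := by
    intro f
    unfold secondMoment
    rw [← Finset.mul_sum]
    field_simp
  have hφsq : ∀ a b, |a| ≤ 1 → |b| ≤ 1 → (φ a - φ b) ^ 2 ≤ (a - b) ^ 2 := fun a b ha hb =>
    sq_le_sq.2 (hφ.abs_sub_le a b ha hb)
  -- Chaining needs a positive radius. If the largest second moment vanishes, every function of the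
  -- class vanishes at the sample points and the process is zero.
  rcases (maxSecondMoment_nonneg 𝓕 x).eq_or_lt with h0 | h0
  · have hzero : ∀ e, signSup (fun (f : 𝓕) x => φ (f.1 x)) e x = 0 := by
      intro e
      have h1 : ∀ (f : 𝓕) i, f.1 (x i) = 0 := by
        intro f i
        have h2 : ∑ i, f.1 (x i) ^ 2 ≤ 0 := by
          rw [hsum]
          have := hF.secondMoment_le_max f.2 x
          rw [← h0] at this
          exact mul_nonpos_of_nonneg_of_nonpos hn0.le this
        have h3 := (Finset.sum_eq_zero_iff_of_nonneg fun i _ => sq_nonneg (f.1 (x i))).1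
          (le_antisymm h2 (Finset.sum_nonneg fun i _ => sq_nonneg _)) i (Finset.mem_univ i)
        simpa using h3
      simp [signSup, h1, hφ.zero]
    simp only [hzero, signMean_const]
    positivity
  · have hs := Real.sqrt_pos.2 h0
    have hst := Real.sqrt_le_sqrt (hF.maxSecondMoment_le x)
    refine (hH.signMean_iSup_le hn (fun (f : 𝓕) i => φ (f.1 (x i))) hs hst (fun f => ?_)
      fun τ hτ => ?_).trans ?_
    · rw [Real.sq_sqrt h0.le]
      calc ∑ i, φ (f.1 (x i)) ^ 2 ≤ ∑ i, f.1 (x i) ^ 2 :=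
            Finset.sum_le_sum fun i _ => sq_le_sq.2 (hφ.abs_le (hF.abs_le_one f.2 _))
        _ = n * secondMoment f.1 x := hsum _
        _ ≤ _ := by gcongr; exact hF.secondMoment_le_max f.2 x
    -- Nets for the class are nets for its image, since `φ` contracts distances on `[-1, 1]`.
    · have hent := hE τ hτ n hn ω
      rw [l2norm_empiricalMeasure hF.envelope_measurable] at hent
      obtain ⟨T, hT, hTc⟩ := exists_finset_cover_of_entropy_le hent
      refine ⟨T, hT, fun f => ?_⟩
      obtain ⟨g, hg, hfg⟩ := hTc f
      refine ⟨g, hg, ?_⟩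
      rw [l2norm_empiricalMeasure ((hF.measurable f f.2).sub (hF.measurable g g.2))] at hfg
      have h2 : secondMoment (f.1 - g.1) x ≤ τ ^ 2 := ((Real.sqrt_lt' hτ).1 hfg).le
      calc ∑ i, (φ (f.1 (x i)) - φ (g.1 (x i))) ^ 2 ≤ ∑ i, (f.1 - g.1) (x i) ^ 2 :=
            Finset.sum_le_sum fun i _ =>
              hφsq _ _ (hF.abs_le_one f.2 _) (hF.abs_le_one g.2 _)
        _ = n * secondMoment (f.1 - g.1) x := hsum _
        _ ≤ _ := by gcongr
    · exact mul_le_mul_of_nonneg_left (hH.mul_sqrt_le hs hst hz) (by positivity)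

/-- The constant in the bound of the mean of the Rademacher process. -/
noncomputable def rademacherConst (B h : ℝ) : ℝ := 4 * B * DyadicBound.chainConst B h

lemma DyadicBound.rademacherConst_pos (hH : DyadicBound H B h₀) : 0 < rademacherConst B h₀ := by
  have := hH.one_le
  have := hH.chainConst_pos
  unfold rademacherConst
  positivity

/-- The arithmetic-geometric inequality, with `b` free: taking `b` to be a deterministic scale makes
a random square root affine in the second moment at no loss of order. -/
lemma sqrt_le_half_add {a b : ℝ} (ha : 0 ≤ a) (hb : 0 < b) : √a ≤ (a / b + b) / 2 := by
  have h1 := Real.sq_sqrt ha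
  have h2 : (a / b + b) / 2 - √a = (√a - b) ^ 2 / (2 * b) := by
    rw [sub_sq, h1]; field_simp; ring
  have : 0 ≤ (√a - b) ^ 2 / (2 * b) := by positivity
  linarith

variable [IsProbabilityMeasure P] [MeasurableSpace Ω] {μ : Measure Ω} [IsProbabilityMeasure μ]

/-- Entropy bound for the mean of the Rademacher process. -/
lemma integral_signMean_signSup_le (hH : DyadicBound H B h₀) (hF : IsCenteredClass P 𝓕 F σ)
    (hne : 𝓕.Nonempty) (hX : IsSample μ P X) (hE : EntropyCondition X 𝓕 F H) (hn : 1 ≤ n)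
    {φ : ℝ → ℝ} (hφ : IsContractionMap φ)
    (hM : ∀ e : Fin n → Bool, AEMeasurable (signSup (fun (f : 𝓕) x => φ (f.1 x)) e)
      (Measure.pi fun _ : Fin n => P))
    {s : ℝ} (hs : 0 < s) (hst : s ≤ l2norm P F)
    (hu : ∫ x, maxSecondMoment 𝓕 x ∂(Measure.pi fun _ : Fin n => P) ≤ s ^ 2) :
    ∫ x, signMean (fun e => signSup (fun (f : 𝓕) x => φ (f.1 x)) e x)
        ∂(Measure.pi fun _ : Fin n => P)
      ≤ rademacherConst B h₀ * (√n * s * √(H (2 * l2norm P F / s))) := by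
  have : Nonempty 𝓕 := hne.to_subtype
  set t := l2norm P F
  have ht : 0 < t := hF.l2norm_pos
  have hκ := hH.chainConst_pos
  have hB := hH.one_le
  have hb1 : ∀ (f : 𝓕) x, |φ (f.1 x)| ≤ 1 := fun f x =>
    (hφ.abs_le (hF.abs_le_one f.2 x)).trans (hF.abs_le_one f.2 x)
  have hI := integrable_signMean_signSup P hb1 hM
  have hIv := hF.integrable_maxSecondMoment (n := n) hne
  have hIt := hF.integrable_secondMoment (n := n) hne
  have hXm := measurable_sample hX n
  have hQ := map_sample_eq hX n
  set K := DyadicBound.chainConst B h₀ * √n * (2 * B * √(H (2 * (t / s))))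
  have hK : 0 ≤ K := by positivity
  -- `G` results from the linear bound with slope parameter `t / s`, after `sqrt_le_half_add` with
  -- `b = s` and with `b = t`. Its mean is at most `K s / 2 + K s / 2 + K s`.
  set G : (Fin n → S) → ℝ := fun x => K / (2 * s) * maxSecondMoment 𝓕 x
    + K * s / (2 * t ^ 2) * secondMoment F x + K * s
  have hIG : Integrable G (Measure.pi fun _ : Fin n => P) :=
    ((hIv.const_mul _).add (hIt.const_mul _)).add (integrable_const _)
  have hGint : ∫ x, G x ∂(Measure.pi fun _ : Fin n => P) ≤ 2 * K * s := by
    simp only [G]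
    rw [integral_add (by exact (hIv.const_mul _).add (hIt.const_mul _)) (integrable_const _),
      integral_add (hIv.const_mul _) (hIt.const_mul _), integral_const_mul, integral_const_mul,
      hF.integral_secondMoment hne hn, integral_const]
    simp only [probReal_univ, one_smul]
    calc _ ≤ K / (2 * s) * s ^ 2 + K * s / (2 * t ^ 2) * t ^ 2 + K * s := by gcongr
      _ = 2 * K * s := by field_simp; ring
  -- The entropy condition is known only along samples `X · ω`, so the pointwise comparison is
  -- integrated over `Ω` rather than over the product space.
  rw [← hQ] at hI hIG hGint ⊢
  rw [integral_map hXm.aemeasurable hIG.aestronglyMeasurable] at hGint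
  rw [integral_map hXm.aemeasurable hI.aestronglyMeasurable]
  calc ∫ ω, signMean (fun e => signSup (fun (f : 𝓕) x => φ (f.1 x)) e fun i : Fin n => X i ω) ∂μ
      ≤ ∫ ω, G (fun i : Fin n => X i ω) ∂μ := by
        refine integral_mono (hI.comp_measurable hXm) (hIG.comp_measurable hXm) fun ω => ?_
        set x : Fin n → S := fun i => X i ω
        calc _ ≤ _ := signMean_signSup_le hH hF hne hE hn ω hφ ((one_le_div hs).2 hst)
          _ = K * (√(maxSecondMoment 𝓕 x) + √(secondMoment F x) / (t / s)) := by
            simp only [K]; ring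
          _ ≤ K * ((maxSecondMoment 𝓕 x / s + s) / 2
              + (secondMoment F x / t + t) / 2 / (t / s)) := by
            gcongr
            · exact sqrt_le_half_add (maxSecondMoment_nonneg _ _) hs
            · exact sqrt_le_half_add (secondMoment_nonneg _ _) ht
          _ = G x := by
            simp only [G]; field_simp; ring
    _ ≤ 2 * K * s := hGint
    _ = _ := by
        simp only [K]
        unfold rademacherConst
        rw [mul_div_assoc]
        ring

/-- Bound of the mean of the empirical process by the entropy at a scale `s` dominating the
empirical second moments. -/
lemma integral_supNorm_le (hH : DyadicBound H B h₀) (hF : IsCenteredClass P 𝓕 F σ)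
    (hne : 𝓕.Nonempty) (hX : IsSample μ P X) (hE : EntropyCondition X 𝓕 F H) (hn : 1 ≤ n)
    {s : ℝ} (hs : 0 < s) (hst : s ≤ l2norm P F)
    (hu : ∫ x, maxSecondMoment 𝓕 x ∂(Measure.pi fun _ : Fin n => P) ≤ s ^ 2) :
    ∫ x, supNorm 𝓕 (fun f => ∑ i, f (x i)) ∂(Measure.pi fun _ : Fin n => P)
      ≤ 2 * rademacherConst B h₀ * (√n * s * √(H (2 * l2norm P F / s))) := by
  have : Nonempty 𝓕 := hne.to_subtype
  have hM : ∀ e : Fin n → Bool, AEMeasurable (signSup (fun (f : 𝓕) x => id (f.1 x)) e)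
      (Measure.pi fun _ : Fin n => P) := fun e =>
    (hF.suitablyMeasurable n fun i => boolSign (e i)).1
  have h1 := integral_signMean_signSup_le hH hF hne hX hE hn (φ := id)
    ⟨rfl, fun _ _ _ _ => le_rfl⟩ hM hs hst hu
  have hZ := (hF.suitablyMeasurable n fun _ => 1).1
  simp only [one_mul] at hZ
  have h2 := integral_le_add_two_mul P (g := fun (f : 𝓕) x => id (f.1 x))
    (fun f => hF.measurable f f.2) (fun f x => hF.abs_le_one f.2 x) hM hZ
    (fun x => Real.iSup_nonneg fun _ => abs_nonneg _) le_rfl fun x b hb => by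
      rw [zero_add]
      refine ciSup_le fun f => ?_
      have := hb f
      simp only [id, hF.centered f f.2, mul_zero, sub_zero] at this
      exact this
  linarith

/-- Bound of the mean of the largest empirical second moment. -/
lemma integral_maxSecondMoment_le (hH : DyadicBound H B h₀) (hF : IsCenteredClass P 𝓕 F σ)
    (hne : 𝓕.Nonempty) (hX : IsSample μ P X) (hE : EntropyCondition X 𝓕 F H) (hn : 1 ≤ n)
    {s : ℝ} (hs : 0 < s) (hst : s ≤ l2norm P F)
    (hu : ∫ x, maxSecondMoment 𝓕 x ∂(Measure.pi fun _ : Fin n => P) ≤ s ^ 2) :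
    n * ∫ x, maxSecondMoment 𝓕 x ∂(Measure.pi fun _ : Fin n => P)
      ≤ n * σ ^ 2 + 4 * rademacherConst B h₀ * (√n * s * √(H (2 * l2norm P F / s))) := by
  have : Nonempty 𝓕 := hne.to_subtype
  have hn0 : (0 : ℝ) < n := by exact_mod_cast hn
  -- Halving the square makes the Lipschitz constant on `[-1, 1]` equal to 1.
  have hφ : IsContractionMap fun a => a ^ 2 / 2 := by
    refine ⟨by norm_num, fun a b ha hb => ?_⟩
    have e1 : a ^ 2 / 2 - b ^ 2 / 2 = (a + b) / 2 * (a - b) := by ring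
    rw [e1, abs_mul]
    refine mul_le_of_le_one_left (abs_nonneg _) ?_
    rw [abs_le] at *
    constructor <;> linarith
  have hM : ∀ e : Fin n → Bool, AEMeasurable (signSup (fun (f : 𝓕) x => f.1 x ^ 2 / 2) e)
      (Measure.pi fun _ : Fin n => P) := fun e => by
    have h := (hF.suitablyMeasurable n fun i => boolSign (e i) / 2).2
    simp only [div_mul_eq_mul_div, mul_div_assoc] at h
    exact h
  have h1 := integral_signMean_signSup_le hH hF hne hX hE hn hφ hM hs hst hu
  have hsq : ∀ (f : 𝓕) x, |f.1 x ^ 2 / 2| ≤ 1 := fun f x =>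
    (hφ.abs_le (hF.abs_le_one f.2 x)).trans (hF.abs_le_one f.2 x)
  have h2 := integral_le_add_two_mul P (g := fun (f : 𝓕) x => f.1 x ^ 2 / 2)
    (fun f => ((hF.measurable f f.2).pow_const 2).div_const 2) hsq hM
    (hF.aemeasurable_maxSecondMoment.const_mul (n / 2 : ℝ))
    (fun x => mul_nonneg (by positivity) (maxSecondMoment_nonneg 𝓕 x))
    (c := n / 2 * σ ^ 2) (by positivity) fun x b hb => by
      have h3 : maxSecondMoment 𝓕 x ≤ σ ^ 2 + 2 / n * b := by
        refine ciSup_le fun f => ?_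
        change |secondMoment f.1 x| ≤ _
        rw [abs_of_nonneg (secondMoment_nonneg _ _)]
        have h4 := (le_abs_self _).trans (hb f)
        have h5 := hF.variance_le f f.2
        rw [integral_div] at h4
        have h6 : ∑ i, f.1 (x i) ^ 2 / 2 = n / 2 * secondMoment f.1 x := by
          unfold secondMoment
          rw [Finset.mul_sum]
          exact Finset.sum_congr rfl fun i _ => by field_simp
        rw [h6] at h4
        have h7 : n / 2 * secondMoment f.1 x ≤ n / 2 * σ ^ 2 + b := by nlinarith
        calc secondMoment f.1 x = 2 / n * (n / 2 * secondMoment f.1 x) := by field_simp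
          _ ≤ 2 / n * (n / 2 * σ ^ 2 + b) := by gcongr
          _ = _ := by field_simp
      calc n / 2 * maxSecondMoment 𝓕 x ≤ n / 2 * (σ ^ 2 + 2 / n * b) := by gcongr
        _ = _ := by field_simp
  rw [integral_const_mul] at h2
  linarith

end Empirical

/-! ### Solving the self-bounding inequality -/

namespace DyadicBound

variable {H : ℝ → ℝ} {B h : ℝ}

/-- For `m ≥ 1` the growth of `H` compares `H y` with `H m`. For `m < 1` no positive lower bound for
`H m` is available, but then `y ≤ 2L` and `H y` is bounded by a multiple of `H 2`; the maximum with
1 covers this case. -/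
lemma le_mul_max (hH : DyadicBound H B h) {L m y : ℝ} (hL : 1 ≤ L) (hy : 2 ≤ y)
    (hym : y ≤ 2 * L * m) : H y ≤ (4 * B * L) ^ 2 * (1 + H 2) * max (H m) 1 := by
  have hB := hH.one_le
  have h2 : 0 ≤ H 2 := hH.nonneg 2 (by norm_num)
  have hm : 0 ≤ m := by
    by_contra! hm
    nlinarith
  have key : ∀ {a b l : ℝ}, 0 ≤ H b → 1 ≤ b → 1 ≤ l → 2 ≤ a → a ≤ l * b →
      H a ≤ (2 * B * l) ^ 2 * H b := by
    intro a b l hb0 hb hl ha hab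
    have h3 : H a ≤ H (l * b) := hH.mono (by simp only [mem_Ici]; linarith)
      (by simp only [mem_Ici]; linarith) hab
    have h4 := (Real.sqrt_le_sqrt h3).trans (hH.sqrt_mul_le hb hl)
    have h5 := pow_le_pow_left₀ (Real.sqrt_nonneg _) h4 2
    rwa [Real.sq_sqrt (hH.nonneg a (by linarith)), mul_pow, Real.sq_sqrt hb0] at h5
  have hmx : (1 : ℝ) ≤ max (H m) 1 := le_max_right _ _
  rcases le_total 1 m with h1 | h1
  · have h3 := key (hH.nonneg m hm) h1 (by linarith : 1 ≤ 2 * L) hy hym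
    calc H y ≤ (2 * B * (2 * L)) ^ 2 * H m := h3
      _ = (4 * B * L) ^ 2 * 1 * H m := by ring
      _ ≤ (4 * B * L) ^ 2 * (1 + H 2) * max (H m) 1 := by
        gcongr
        · exact hH.nonneg m hm
        · linarith
        · exact le_max_left _ _
  · have h3 := key h2 (by norm_num : (1 : ℝ) ≤ 2) hL hy (by nlinarith)
    calc H y ≤ (2 * B * L) ^ 2 * H 2 := h3
      _ = (2 * B * L) ^ 2 * H 2 * 1 := by ring
      _ ≤ (4 * B * L) ^ 2 * (1 + H 2) * max (H m) 1 := by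
        gcongr
        · linarith
        · linarith

end DyadicBound

/-- The final constant, in terms of the constant `K` of the bound of the mean at a given scale. -/
noncomputable def momentConst (B L K h₁ : ℝ) : ℝ :=
  2 * K + (4 * K ^ 2 + K) * ((4 * B * L) ^ 2 * (1 + h₁))

/-- Solving the self-bounding inequality for the empirical second moment `u`: either `u` is
comparable with `σ²`, or the mean `E` is bounded by the entropy at scale `√u`. -/
lemma le_or_le_entropy {H : ℝ → ℝ} {B h K σ t u E n : ℝ} (hH : DyadicBound H B h)
    (hK : 0 < K) (hσ : 0 < σ) (hσt : σ ≤ t) (hut : u ≤ t ^ 2) (hn : 0 < n)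
    (hE : ∀ s, 0 < s → s ≤ t → u ≤ s ^ 2 → E ≤ K * (√n * s * √(H (2 * t / s))))
    (hV : ∀ s, 0 < s → s ≤ t → u ≤ s ^ 2 →
      n * u ≤ n * σ ^ 2 + 2 * K * (√n * s * √(H (2 * t / s)))) :
    E ≤ 2 * K * (√n * σ * √(H (2 * t / σ))) ∨
      (2 * σ ^ 2 < u ∧ E ≤ 4 * K ^ 2 * H (2 * t / √u)) := by
  have ht : 0 < t := hσ.trans_le hσt
  have hmem : ∀ {s}, 0 < s → s ≤ t → 2 ≤ 2 * t / s := fun {s} hs hst => by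
    rw [le_div_iff₀ hs]; linarith
  rcases le_or_gt u (2 * σ ^ 2) with hc | hc
  · left
    -- This is the least scale above `σ` allowed by `u ≤ s²`, and it is at most `2σ`.
    set s := max σ √u
    have hs : 0 < s := hσ.trans_le (le_max_left _ _)
    have hst : s ≤ t := max_le hσt (Real.sqrt_le_iff.2 ⟨ht.le, hut⟩)
    have hs2 : s ≤ 2 * σ := max_le (by linarith) (Real.sqrt_le_iff.2 ⟨by linarith, by nlinarith⟩)
    have hus : u ≤ s ^ 2 := (Real.sqrt_le_left hs.le).1 (le_max_right _ _)
    have h1 : H (2 * t / s) ≤ H (2 * t / σ) := by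
      refine hH.mono ?_ ?_ ?_
      · simp only [mem_Ici]; linarith [hmem hs hst]
      · simp only [mem_Ici]; linarith [hmem hσ hσt]
      · gcongr
        exact le_max_left _ _
    calc E ≤ K * (√n * s * √(H (2 * t / s))) := hE s hs hst hus
      _ ≤ K * (√n * (2 * σ) * √(H (2 * t / σ))) := by gcongr
      _ = _ := by ring
  · right
    refine ⟨hc, ?_⟩
    have hu : 0 < u := (by positivity : 0 ≤ 2 * σ ^ 2).trans_lt hc
    have hs := Real.sqrt_pos.2 hu
    have hsq := Real.sq_sqrt hu.le
    have hst : √u ≤ t := Real.sqrt_le_iff.2 ⟨ht.le, hut⟩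
    have h1 := hE _ hs hst hsq.ge
    have h2 := hV _ hs hst hsq.ge
    set q := √(H (2 * t / √u))
    have hq : q ^ 2 = H (2 * t / √u) :=
      Real.sq_sqrt (hH.nonneg _ (by linarith [hmem hs hst]))
    have hn2 := Real.sq_sqrt hn.le
    have hn1 := Real.sqrt_pos.2 hn
    -- From `nσ² < n u / 2` the variance term moves to the left, leaving `n u ≤ 4K √n √u q`; one
    -- factor `√n √u` then cancels.
    have h3 : (√n * √u) * (√n * √u) ≤ (4 * K * q) * (√n * √u) := by
      have : (√n * √u) * (√n * √u) = n * u := by rw [← hn2, ← hsq]; ring_nf; simp [hn2, hsq]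
      nlinarith
    have h4 : √n * √u ≤ 4 * K * q := le_of_mul_le_mul_right h3 (by positivity)
    calc E ≤ K * (√n * √u * q) := h1
      _ ≤ K * (4 * K * q * q) := by gcongr
      _ = _ := by rw [← hq]; ring

/-- When `u` is comparable with `σ²` the variance term suffices. Otherwise `H(2t/√u) ≤ H(2t/σ)`
gives the second bound at once; the truncated argument in the first also requires comparing `2t/√u`
with `√n t`. The bound by `√n t` is the scale `s = t`. -/
lemma bounds_of_self_bounding {H : ℝ → ℝ} {B h K L h₁ σ t u E n : ℝ} (hH : DyadicBound H B h)
    (hK : 0 < K) (hL : 1 ≤ L) (hh : H 2 ≤ h₁) (hσ : 0 < σ) (hσt : σ ≤ t) (hut : u ≤ t ^ 2)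
    (hn : 0 < n)
    (hE : ∀ s, 0 < s → s ≤ t → u ≤ s ^ 2 → E ≤ K * (√n * s * √(H (2 * t / s))))
    (hV : ∀ s, 0 < s → s ≤ t → u ≤ s ^ 2 →
      n * u ≤ n * σ ^ 2 + 2 * K * (√n * s * √(H (2 * t / s)))) :
    E ≤ momentConst B L K h₁ * min (√n * t) (max (max (√n * σ * √(H (2 * t / σ)))
        (H (min (2 * t / σ) (√n * t / L)))) 1) ∧
      E ≤ momentConst B L K h₁ * max (√n * σ * √(H (2 * t / σ))) (H (2 * t / σ)) := by
  have ht : 0 < t := hσ.trans_le hσt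
  have hB := hH.one_le
  have hn1 := Real.sqrt_pos.2 hn
  have hn2 := Real.sq_sqrt hn.le
  have h2 : 0 < H 2 := hH.pos.trans_le hH.le_two
  set R := (4 * B * L) ^ 2 * (1 + h₁)
  have hBL : 1 ≤ 4 * B * L := by nlinarith
  have hR : 1 + H 2 ≤ R := by
    have : 1 ≤ (4 * B * L) ^ 2 := one_le_pow₀ hBL
    simp only [R]
    nlinarith
  have hR1 : 1 ≤ R := by linarith
  have hM : momentConst B L K h₁ = 2 * K + (4 * K ^ 2 + K) * R := rfl
  have hMK : 2 * K ≤ momentConst B L K h₁ := by rw [hM]; nlinarith [sq_nonneg K]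
  have hMR : 4 * K ^ 2 * R ≤ momentConst B L K h₁ := by rw [hM]; nlinarith
  have hMR' : K * R ≤ momentConst B L K h₁ := by rw [hM]; nlinarith [sq_nonneg K]
  have hM0 : 0 < momentConst B L K h₁ := by linarith
  have hsqrt : ∀ {a : ℝ}, √a ≤ max a 1 := fun {a} => by
    rcases le_total a 1 with h | h
    · exact (Real.sqrt_le_one.2 h).trans (le_max_right _ _)
    · exact (Real.sqrt_le_iff.2 ⟨by linarith, by nlinarith⟩).trans (le_max_left _ _)
  set m := min (2 * t / σ) (√n * t / L)
  have hHy : ∀ {y : ℝ}, 2 ≤ y → y ≤ 2 * t / σ → y ≤ 2 * (√n * t) →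
      H y ≤ R * max (H m) 1 := by
    intro y hy h3 h4
    refine (hH.le_mul_max hL hy (m := m) ?_).trans ?_
    · rw [mul_min_of_nonneg _ _ (by linarith)]
      refine le_min ?_ ?_
      · have : 0 < 2 * t / σ := by positivity
        nlinarith
      · have : 2 * L * (√n * t / L) = 2 * (√n * t) := by field_simp
        rw [this]
        exact h4
    · simp only [R]
      gcongr
  have h2t : E ≤ K * √(H 2) * (√n * t) := by
    have h3 := hE t ht le_rfl hut
    rw [mul_div_assoc, div_self ht.ne', mul_one] at h3
    linarith
  have hs2 : √(H 2) ≤ R := hsqrt.trans (max_le (by linarith) (by linarith))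
  have hfin : ∀ {a b c : ℝ}, a ≤ momentConst B L K h₁ → 0 ≤ b → b ≤ c → E ≤ a * b →
      E ≤ momentConst B L K h₁ * c := by
    intro a b c ha hb hbc hEa
    refine hEa.trans ?_
    gcongr
  have hcase := le_or_le_entropy hH hK hσ hσt hut hn hE hV
  have hmem : 2 ≤ 2 * t / σ := by rw [le_div_iff₀ hσ]; linarith
  refine ⟨?_, ?_⟩
  · rw [mul_min_of_nonneg _ _ hM0.le]
    refine le_min ?_ ?_
    · refine hfin (a := K * √(H 2)) ?_ (by positivity) le_rfl h2t
      exact le_trans (by gcongr) hMR'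
    · rcases hcase with h3 | ⟨hu, h3⟩
      · exact hfin hMK (by positivity) ((le_max_left _ _).trans (le_max_left _ _)) h3
      have hmax : max (H m) 1 ≤ max (max (√n * σ * √(H (2 * t / σ))) (H m)) 1 :=
        max_le_max (le_max_right _ _) le_rfl
      have hu0 : 0 < u := (by positivity : 0 ≤ 2 * σ ^ 2).trans_lt hu
      have hs := Real.sqrt_pos.2 hu0
      have hsq := Real.sq_sqrt hu0.le
      have hst : √u ≤ t := Real.sqrt_le_iff.2 ⟨ht.le, hut⟩
      have hσu : σ ≤ √u := Real.le_sqrt_of_sq_le (by nlinarith)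
      -- If `n u ≥ 1`, then `2t/√u ≤ 2√n t`, so the entropy at scale `√u` is controlled by `H m`.
      rcases le_or_gt 1 (n * u) with hnu | hnu
      · have hnu' : 1 ≤ √n * √u := by
          rw [← Real.sqrt_mul hn.le]
          exact Real.one_le_sqrt.2 hnu
        have h4 := hHy (y := 2 * t / √u) (by rw [le_div_iff₀ hs]; linarith) (by gcongr)
          (by rw [div_le_iff₀ hs]; nlinarith)
        refine hfin hMR (by positivity) hmax (h3.trans ?_)
        rw [mul_assoc (4 * K ^ 2)]
        exact mul_le_mul_of_nonneg_left h4 (by positivity : 0 ≤ 4 * K ^ 2)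
      -- If `n u < 1 ≤ √n t`, the scale `s = 1/√n` is admissible and gives `√H(2√n t)`; moreover `√n
      -- σ ≤ 1`, so `2√n t ≤ 2t/σ`. If `√n t < 1`, the scale `t` gives a constant, absorbed by the
      -- final 1.
      · rcases le_or_gt 1 (√n * t) with hnt | hnt
        · have h4 := hE (1 / √n) (by positivity) (by rw [div_le_iff₀ hn1]; linarith) (by
            rw [div_pow, hn2, one_pow, le_div_iff₀ hn]; linarith)
          have e1 : 2 * t / (1 / √n) = 2 * (√n * t) := by field_simp
          have e2 : √n * (1 / √n) = 1 := by field_simp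
          rw [e1, e2, one_mul] at h4
          have hnσ : √n * σ ≤ 1 := by
            have : (√n * σ) ^ 2 ≤ 1 := by
              rw [mul_pow, hn2]
              have h5 := mul_lt_mul_of_pos_left hu hn
              have h6 : 0 < n * σ ^ 2 := by positivity
              linarith
            exact (pow_le_one_iff_of_nonneg (by positivity) two_ne_zero).1 this
          have h5 := hHy (y := 2 * (√n * t)) (by linarith)
            (by
              rw [le_div_iff₀ hσ]
              calc 2 * (√n * t) * σ = √n * σ * (2 * t) := by ring
                _ ≤ 1 * (2 * t) := by gcongr
                _ = 2 * t := one_mul _) le_rfl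
          refine hfin hMR' (by positivity) hmax (h4.trans ?_)
          rw [mul_assoc]
          exact mul_le_mul_of_nonneg_left (hsqrt.trans (max_le h5
            (one_le_mul_of_one_le_of_one_le hR1 (le_max_right _ _)))) hK.le
        · refine hfin (a := K * √(H 2)) (le_trans (by gcongr) hMR') (by positivity)
            (hnt.le.trans (le_max_right _ _)) h2t
  · rcases hcase with h3 | ⟨hu, h3⟩
    · exact hfin hMK (by positivity) (le_max_left _ _) h3
    · have hu0 : 0 < u := (by positivity : 0 ≤ 2 * σ ^ 2).trans_lt hu
      have hs := Real.sqrt_pos.2 hu0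
      have hst : √u ≤ t := Real.sqrt_le_iff.2 ⟨ht.le, hut⟩
      have hσu : σ ≤ √u := Real.le_sqrt_of_sq_le (by nlinarith)
      have hmu : 2 ≤ 2 * t / √u := by rw [le_div_iff₀ hs]; linarith
      have h4 : H (2 * t / √u) ≤ H (2 * t / σ) := by
        refine hH.mono ?_ ?_ (by gcongr) <;> simp only [mem_Ici] <;> linarith
      refine hfin (a := 4 * K ^ 2) ?_ (hH.nonneg _ (by linarith)) (h4.trans (le_max_right _ _)) h3
      nlinarith [sq_nonneg K]

/-- The assumption reads `√c √H ≤ √n σ`; multiplying by `√H` bounds the entropy term by the variance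
term. -/
lemma le_of_entropy_le_variance {H : ℝ → ℝ} {M c σ x E n : ℝ} (hM : 0 < M) (hc : 0 < c)
    (hσ : 0 < σ) (hn : 0 < n) (hHx : 0 ≤ H x) (hE : E ≤ M * max (√n * σ * √(H x)) (H x))
    (hcn : c * H x ≤ n * σ ^ 2) : E ≤ M * (1 + 1 / √c) * (√n * σ * √(H x)) := by
  have hc1 := Real.sqrt_pos.2 hc
  have h1 : √c * √(H x) ≤ √n * σ := by
    rw [← Real.sqrt_mul hc.le, ← Real.sqrt_sq hσ.le, ← Real.sqrt_mul hn.le]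
    exact Real.sqrt_le_sqrt hcn
  have h2 : H x ≤ 1 / √c * (√n * σ * √(H x)) := by
    calc H x = 1 / √c * (√c * √(H x) * √(H x)) := by
          rw [mul_assoc, Real.mul_self_sqrt hHx]; field_simp
      _ ≤ _ := by gcongr
  rw [mul_assoc]
  refine hE.trans ?_
  gcongr
  have h3 : 0 ≤ √n * σ * √(H x) := by positivity
  have h4 : 0 ≤ 1 / √c * (√n * σ * √(H x)) := by positivity
  rw [one_add_mul]
  exact max_le (by linarith) (by linarith)

/-! ### Dyadic growth of entropy bounds -/

namespace IsEntropyBound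

variable {H : ℝ → ℝ}

lemma pos (hH : IsEntropyBound H) {x : ℝ} (hx : 1 ≤ x) : 0 < H x :=
  (hH.nonneg (1 / 2) (by norm_num)).trans_lt
    (hH.strictMonoOn (by simp) (by simp only [mem_Ici]; linarith) (by linarith))

lemma mono (hH : IsEntropyBound H) {x y : ℝ} (hx : 1 ≤ x) (hxy : x ≤ y) : H x ≤ H y :=
  hH.strictMonoOn.monotoneOn (by simp only [mem_Ici]; linarith)
    (by simp only [mem_Ici]; linarith) hxy

/-- The dyadic entropy sum is dominated by the entropy integral. -/
lemma sum_le_lintegral (hH : IsEntropyBound H) (N : ℕ) {x : ℝ} (hx : 1 ≤ x) :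
    ENNReal.ofReal ((∑ k ∈ Finset.range N, √(H (2 ^ k * x)) / 2 ^ k) / (4 * x))
      ≤ ∫⁻ u in Ioi x, ENNReal.ofReal (√(H u) / u ^ 2) := by
  induction N generalizing x with
  | zero => simp
  | succ N ih =>
    have hx0 : 0 < x := by linarith
    have e1 : (∑ k ∈ Finset.range (N + 1), √(H (2 ^ k * x)) / 2 ^ k) / (4 * x)
        = √(H x) / (4 * x ^ 2) * x
          + (∑ k ∈ Finset.range N, √(H (2 ^ k * (2 * x))) / 2 ^ k) / (4 * (2 * x)) := by
      rw [Finset.sum_range_succ']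
      have : ∑ k ∈ Finset.range N, √(H (2 ^ (k + 1) * x)) / 2 ^ (k + 1)
          = (∑ k ∈ Finset.range N, √(H (2 ^ k * (2 * x))) / 2 ^ k) / 2 := by
        rw [Finset.sum_div]
        refine Finset.sum_congr rfl fun k _ => ?_
        rw [pow_succ, mul_assoc, div_div]
      rw [this]
      generalize ∑ k ∈ Finset.range N, √(H (2 ^ k * (2 * x))) / 2 ^ k = b
      simp only [pow_zero, one_mul, div_one]
      field_simp
      ring
    have hunion : Ioi x = Ioc x (2 * x) ∪ Ioi (2 * x) :=
      (Ioc_union_Ioi_eq_Ioi (by linarith)).symm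
    have hdisj : Disjoint (Ioc x (2 * x)) (Ioi (2 * x)) :=
      Set.disjoint_left.2 fun u hu hu' => not_lt.2 hu.2 hu'
    rw [e1, ENNReal.ofReal_add (by positivity)
      (div_nonneg (Finset.sum_nonneg fun _ _ => by positivity) (by positivity)), hunion,
      lintegral_union measurableSet_Ioi hdisj]
    refine add_le_add ?_ (ih (by linarith))
    -- On an interval of length `x` the integrand is at least its value with `u` replaced by `x` in
    -- `H` and by `2x` in the denominator; the remaining terms are the same sum started at `2x`.
    calc ENNReal.ofReal (√(H x) / (4 * x ^ 2) * x)
        = ∫⁻ _u in Ioc x (2 * x), ENNReal.ofReal (√(H x) / (4 * x ^ 2)) := by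
          rw [setLIntegral_const, Real.volume_Ioc, ENNReal.ofReal_mul (by positivity)]
          congr 2
          ring
      _ ≤ _ := by
          refine setLIntegral_mono' measurableSet_Ioc fun u hu => ENNReal.ofReal_le_ofReal ?_
          have hu0 : 0 < u := hx0.trans hu.1
          have h1 : u ^ 2 ≤ 4 * x ^ 2 := by nlinarith [hu.1, hu.2]
          have h2 : H x ≤ H u := hH.mono hx hu.1.le
          gcongr

lemma dyadicBound (hH : IsEntropyBound H) {A C D : ℝ} (h : AdmissibleConstants H A C D) :
    DyadicBound H (4 * C) ((D * Real.exp (-(4 * A)) / (2 * C)) ^ 2) := by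
  have hC := h.one_le_C
  have h1 : 0 < √(H 1) := Real.sqrt_pos.2 (hH.pos le_rfl)
  have h2 : 0 < H 2 := hH.pos (by norm_num)
  have h2' := Real.sqrt_pos.2 h2
  have hD : 0 < D := by
    -- Positivity of `D` is not assumed; it follows since the entropy integral is positive.
    have h3 := (hH.sum_le_lintegral 1 le_rfl).trans h.integral_le
    simp only [Finset.sum_range_one, pow_zero, div_one, mul_one] at h3
    by_contra! hD
    rw [ENNReal.ofReal_eq_zero.2 hD, nonpos_iff_eq_zero, ENNReal.ofReal_eq_zero] at h3
    have : 0 < √(H 1) / 4 := by positivity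
    linarith
  refine ⟨hH.nonneg, hH.strictMonoOn.monotoneOn, by positivity, ?_, fun x hx N => ?_⟩
  -- At `x = 2` the logarithmic condition reads `D / (2C √(H 2)) ≤ exp (4A)`, which is a lower bound
  -- for `H 2` in terms of `A`, `C`, `D` only.
  · have h3 := h.log_le 2 le_rfl
    rw [div_le_iff₀ (by norm_num), Real.log_le_iff_le_exp (by positivity),
      div_le_iff₀ (by positivity)] at h3
    have h4 : D * Real.exp (-(4 * A)) / (2 * C) ≤ √(H 2) := by
      rw [div_le_iff₀ (by positivity), Real.exp_neg, ← div_eq_mul_inv,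
        div_le_iff₀ (Real.exp_pos _)]
      have e : A * 2 ^ 2 = 4 * A := by ring
      rw [e] at h3
      linarith
    calc _ ≤ √(H 2) ^ 2 := by gcongr
      _ = H 2 := Real.sq_sqrt h2.le
  · have hx0 : 0 < x := by linarith
    have hHx := Real.sqrt_pos.2 (hH.pos hx)
    have h3 := h.tail_le x hx
    rw [ENNReal.div_le_iff (by simpa using by positivity) ENNReal.ofReal_ne_top,
      ← ENNReal.ofReal_mul (by linarith)] at h3
    have h4 := (ENNReal.ofReal_le_ofReal_iff (by positivity)).1
      ((hH.sum_le_lintegral N hx).trans h3)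
    rw [div_le_iff₀ (by positivity)] at h4
    calc _ ≤ C * (√(H x) / x) * (4 * x) := h4
      _ = _ := by field_simp

/-- The second dyadic term from `x = 1` already contributes `√(H 2) / 8` to the entropy integral.
This keeps `H 2` out of the final constant. -/
lemma two_le_of_admissible (hH : IsEntropyBound H) {A C D : ℝ}
    (h : AdmissibleConstants H A C D) : H 2 ≤ 64 * D ^ 2 := by
  have h2 : 0 ≤ H 2 := (hH.pos (by norm_num)).le
  have h3 := (hH.sum_le_lintegral 2 le_rfl).trans h.integral_le
  have h4 : √(H 2) / 8 ≤
      (∑ k ∈ Finset.range 2, √(H (2 ^ k * 1)) / 2 ^ k) / (4 * 1) := by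
    simp only [Finset.sum_range_succ, Finset.sum_range_zero]
    norm_num
    linarith [Real.sqrt_nonneg (H 1)]
  have h5 : 0 < √(H 2) / 8 := by
    have := Real.sqrt_pos.2 (hH.pos (x := 2) (by norm_num))
    positivity
  have h6 : √(H 2) / 8 ≤ D :=
    (ENNReal.ofReal_le_ofReal_iff'.1 ((ENNReal.ofReal_le_ofReal h4).trans h3)).resolve_right
      (not_le.2 h5)
  calc H 2 = 64 * (√(H 2) / 8) ^ 2 := by rw [div_pow, Real.sq_sqrt h2]; ring
    _ ≤ _ := by gcongr

/-- Regular variation of exponent smaller than `2` gives control of the dyadic entropy sums. -/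
lemma exists_dyadicBound (hH : IsEntropyBound H) : ∃ B, DyadicBound H B (H 2) := by
  obtain ⟨α, -, hα, hrv⟩ := hH.regularlyVarying
  have hlim := hrv 2 (by norm_num)
  have h4 : (2 : ℝ) ^ α < 4 := by
    calc (2 : ℝ) ^ α < 2 ^ (2 : ℝ) := Real.rpow_lt_rpow_of_exponent_lt (by norm_num) hα
      _ = 4 := by norm_num
  obtain ⟨ρ, hρ1, hρ2⟩ := exists_between h4
  have hρ0 : 0 < ρ := (Real.rpow_pos_of_pos (by norm_num) α).trans hρ1
  obtain ⟨y, hy⟩ := eventually_atTop.1 (hlim.eventually_lt_const hρ1)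
  set z := max y 1
  have hz : 1 ≤ z := le_max_right _ _
  -- Since `2 ^ α < 4`, the ratio `H (2x) / H x` is eventually below some `ρ < 4`, so the dyadic
  -- terms decay geometrically with ratio `q < 1` from `z` on.
  set q := √ρ / 2
  have hq0 : 0 ≤ q := by positivity
  have hq1 : q < 1 := by
    have : √ρ < 2 := (Real.sqrt_lt' (by norm_num)).2 (by linarith)
    simp only [q]
    linarith
  have hstep : ∀ x, z ≤ x → √(H (2 * x)) ≤ 2 * q * √(H x) := by
    intro x hx
    have hx1 : 1 ≤ x := hz.trans hx
    have h5 := (div_lt_iff₀ (hH.pos hx1)).1 (hy x ((le_max_left _ _).trans hx))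
    have h6 : 2 * q = √ρ := by simp only [q]; ring
    rw [h6, ← Real.sqrt_mul hρ0.le]
    exact Real.sqrt_le_sqrt h5.le
  have hgeo : ∀ k : ℕ, ∀ x, z ≤ x → √(H (2 ^ k * x)) / 2 ^ k ≤ q ^ k * √(H x) := by
    intro k
    induction k with
    | zero => simp
    | succ k ih =>
      intro x hx
      have h7 := ih (2 * x) (by linarith)
      have h8 := hstep x hx
      calc √(H (2 ^ (k + 1) * x)) / 2 ^ (k + 1)
          = √(H (2 ^ k * (2 * x))) / 2 ^ k / 2 := by rw [pow_succ, mul_assoc, div_div]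
        _ ≤ q ^ k * √(H (2 * x)) / 2 := by gcongr
        _ ≤ q ^ k * (2 * q * √(H x)) / 2 := by gcongr
        _ = _ := by ring
  have hsum : ∀ N : ℕ, ∀ x, z ≤ x →
      ∑ k ∈ Finset.range N, √(H (2 ^ k * x)) / 2 ^ k ≤ (1 - q)⁻¹ * √(H x) := by
    intro N x hx
    calc _ ≤ ∑ k ∈ Finset.range N, q ^ k * √(H x) := Finset.sum_le_sum fun k _ => hgeo k x hx
      _ = (∑ k ∈ Finset.range N, q ^ k) * √(H x) := by rw [Finset.sum_mul]
      _ ≤ _ := by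
        gcongr
        rw [← tsum_geometric_of_lt_one hq0 hq1]
        exact (summable_geometric_of_lt_one hq0 hq1).sum_le_tsum _ fun _ _ => by positivity
  -- For `1 ≤ x ≤ z`, `m` doublings pass `z`. The first `m` terms are each at most `√H(2^m x)`, the
  -- rest form a geometric tail from `2^m x`, and `c` compares `√H(2^m x)` with `√H(x)` uniformly
  -- over this bounded range.
  obtain ⟨m, hm⟩ := pow_unbounded_of_one_lt z (by norm_num : (1 : ℝ) < 2)
  have hq2 : 0 < (1 - q)⁻¹ := inv_pos.2 (by linarith)
  have h1 := Real.sqrt_pos.2 (hH.pos le_rfl)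
  set c := √(H (2 ^ m * z)) / √(H 1)
  refine ⟨(1 - q)⁻¹ + (m + (1 - q)⁻¹) * c, hH.nonneg, hH.strictMonoOn.monotoneOn,
    hH.pos (by norm_num), le_rfl, fun x hx N => ?_⟩
  have hHx := Real.sqrt_nonneg (H x)
  have hc : 0 ≤ c := by positivity
  rcases le_total z x with hxz | hxz
  · refine (hsum N x hxz).trans ?_
    gcongr
    have : 0 ≤ (m + (1 - q)⁻¹) * c := by positivity
    linarith
  · have hx0 : 0 < x := by linarith
    have h2m : (1 : ℝ) ≤ 2 ^ m := one_le_pow₀ (by norm_num)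
    have hzm : z ≤ 2 ^ m * x := by nlinarith
    have htop : √(H (2 ^ m * x)) ≤ c * √(H x) := by
      calc √(H (2 ^ m * x)) ≤ √(H (2 ^ m * z)) :=
            Real.sqrt_le_sqrt (hH.mono (hz.trans hzm) (by gcongr))
        _ = c * √(H 1) := by simp only [c]; field_simp
        _ ≤ c * √(H x) := by
          gcongr
          exact hH.mono le_rfl hx
    calc ∑ k ∈ Finset.range N, √(H (2 ^ k * x)) / 2 ^ k
        ≤ ∑ k ∈ Finset.range (m + N), √(H (2 ^ k * x)) / 2 ^ k :=
          Finset.sum_le_sum_of_subset_of_nonneg (Finset.range_subset_range.2 (by omega))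
            fun _ _ _ => by positivity
      _ = ∑ k ∈ Finset.range m, √(H (2 ^ k * x)) / 2 ^ k
          + ∑ j ∈ Finset.range N, √(H (2 ^ (m + j) * x)) / 2 ^ (m + j) :=
          Finset.sum_range_add _ _ _
      _ ≤ ∑ _k ∈ Finset.range m, √(H (2 ^ m * x))
          + ∑ j ∈ Finset.range N, √(H (2 ^ j * (2 ^ m * x))) / 2 ^ j := by
          refine add_le_add (Finset.sum_le_sum fun k hk => ?_)
            (Finset.sum_le_sum fun j _ => ?_)
          · have h2k : (1 : ℝ) ≤ 2 ^ k := one_le_pow₀ (by norm_num)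
            refine (div_le_self (Real.sqrt_nonneg _) h2k).trans (Real.sqrt_le_sqrt ?_)
            refine hH.mono (by nlinarith) ?_
            gcongr
            · norm_num
            · exact (Finset.mem_range.1 hk).le
          · rw [pow_add, mul_comm ((2 : ℝ) ^ m), mul_assoc]
            gcongr
            nlinarith [pow_pos (by norm_num : (0 : ℝ) < 2) j]
      _ ≤ m * √(H (2 ^ m * x)) + (1 - q)⁻¹ * √(H (2 ^ m * x)) := by
          rw [Finset.sum_const, Finset.card_range, nsmul_eq_mul]
          gcongr
          exact hsum N _ hzm
      _ = (m + (1 - q)⁻¹) * √(H (2 ^ m * x)) := by ring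
      _ ≤ (m + (1 - q)⁻¹) * (c * √(H x)) := by gcongr
      _ ≤ _ := by
          rw [add_mul]
          have : 0 ≤ (1 - q)⁻¹ * √(H x) := by positivity
          linarith

end IsEntropyBound

/-! ### Assembly of the moment bounds -/

lemma momentConst_pos {B L K h₁ : ℝ} (hK : 0 < K) (hh : 0 ≤ h₁) : 0 < momentConst B L K h₁ := by
  unfold momentConst
  positivity

lemma supSum_eq {Ω S : Type*} (X : ℕ → Ω → S) (𝓕 : Set (S → ℝ)) (n : ℕ) (ω : Ω) :
    supSum X 𝓕 n ω
      = (fun x : Fin n → S => supNorm 𝓕 fun f => ∑ i, f (x i)) fun i => X i ω := by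
  simp only [supSum, Finset.sum_range]

lemma aemeasurable_supNorm_sum {S : Type*} [MeasurableSpace S] {P : Measure S}
    {𝓕 : Set (S → ℝ)} {F : S → ℝ} {σ : ℝ} {n : ℕ} (hF : IsCenteredClass P 𝓕 F σ) :
    AEMeasurable (fun x : Fin n → S => supNorm 𝓕 fun f => ∑ i, f (x i))
      (Measure.pi fun _ => P) := by
  simpa only [one_mul] using (hF.suitablyMeasurable n fun _ => 1).1

lemma supSum_nonneg {Ω S : Type*} (X : ℕ → Ω → S) (𝓕 : Set (S → ℝ)) (n : ℕ) (ω : Ω) :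
    0 ≤ supSum X 𝓕 n ω := Real.iSup_nonneg fun _ => abs_nonneg _

section Main

variable {Ω S : Type*} [MeasurableSpace Ω] [MeasurableSpace S] {μ : Measure Ω}
  [IsProbabilityMeasure μ] {P : Measure S} {X : ℕ → Ω → S}
  {𝓕 : Set (S → ℝ)} {F : S → ℝ} {σ : ℝ} {H : ℝ → ℝ} {B h₀ h₁ L : ℝ} {n : ℕ}

lemma integrable_supSum (hF : IsCenteredClass P 𝓕 F σ) (hX : IsSample μ P X) :
    Integrable (supSum X 𝓕 n) μ := by
  have hZ := aemeasurable_supNorm_sum (n := n) hF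
  rw [← map_sample_eq hX n] at hZ
  have hm : AEMeasurable (supSum X 𝓕 n) μ := by
    have := hZ.comp_aemeasurable (measurable_sample hX n).aemeasurable
    exact this.congr (ae_of_all _ fun ω => (supSum_eq X 𝓕 n ω).symm)
  refine Integrable.of_bound hm.aestronglyMeasurable n (ae_of_all _ fun ω => ?_)
  rw [Real.norm_eq_abs, abs_of_nonneg (supSum_nonneg X 𝓕 n ω)]
  refine Real.iSup_le (fun f => ?_) (Nat.cast_nonneg n)
  calc |∑ i ∈ Finset.range n, f.1 (X i ω)| ≤ ∑ i ∈ Finset.range n, |f.1 (X i ω)| :=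
        Finset.abs_sum_le_sum_abs _ _
    _ ≤ ∑ _i ∈ Finset.range n, (1 : ℝ) :=
        Finset.sum_le_sum fun i _ => hF.abs_le_one f.2 _
    _ = n := by simp

lemma integral_supSum_eq (hF : IsCenteredClass P 𝓕 F σ) (hX : IsSample μ P X) :
    ∫ ω, supSum X 𝓕 n ω ∂μ
      = ∫ x, supNorm 𝓕 (fun f => ∑ i, f (x i)) ∂(Measure.pi fun _ : Fin n => P) := by
  have hZ := aemeasurable_supNorm_sum (n := n) hF
  rw [← map_sample_eq hX n] at hZ ⊢
  rw [integral_map (measurable_sample hX n).aemeasurable hZ.aestronglyMeasurable]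
  simp only [supSum_eq]

variable [IsProbabilityMeasure P]

/-- The two moment bounds, with an explicit constant. -/
lemma integral_supSum_le (hH : DyadicBound H B h₀) (hh : H 2 ≤ h₁) (hL : 1 ≤ L)
    (hX : IsSample μ P X) (hF : IsCenteredClass P 𝓕 F σ) (hE : EntropyCondition X 𝓕 F H)
    (hn : 1 ≤ n) :
    ∫ ω, supSum X 𝓕 n ω ∂μ ≤ momentConst B L (2 * rademacherConst B h₀) h₁ *
        min (√n * l2norm P F) (max (max (√n * σ * √(H (2 * l2norm P F / σ)))
          (H (min (2 * l2norm P F / σ) (√n * l2norm P F / L)))) 1) ∧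
      ∫ ω, supSum X 𝓕 n ω ∂μ ≤ momentConst B L (2 * rademacherConst B h₀) h₁ *
        max (√n * σ * √(H (2 * l2norm P F / σ))) (H (2 * l2norm P F / σ)) := by
  have hn0 : (0 : ℝ) < n := by exact_mod_cast hn
  have hK := hH.rademacherConst_pos
  have hh₁ : 0 ≤ h₁ := (hH.pos.le.trans hH.le_two).trans hh
  have hM : 0 < momentConst B L (2 * rademacherConst B h₀) h₁ :=
    momentConst_pos (by positivity) hh₁
  have ht := hF.l2norm_pos
  have hσ := hF.sigma_pos
  -- For an empty class the real supremum takes the default value 0.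
  rcases 𝓕.eq_empty_or_nonempty with he | hne
  · have h0 : ∀ ω, supSum X 𝓕 n ω = 0 := fun ω => by
      subst he
      simp [supSum, supNorm]
    simp only [h0, integral_zero]
    exact ⟨mul_nonneg hM.le (le_min (by positivity) (le_max_of_le_right zero_le_one)),
      mul_nonneg hM.le (le_max_of_le_left (by positivity))⟩
  · rw [integral_supSum_eq hF hX]
    refine bounds_of_self_bounding
      (u := ∫ x, maxSecondMoment 𝓕 x ∂(Measure.pi fun _ : Fin n => P)) hH (by positivity) hL hh hσ
      (abs_le_of_sq_le_sq' hF.sigma_le ht.le).2 ?_ hn0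
      (fun s hs hst hu => integral_supNorm_le hH hF hne hX hE hn hs hst hu)
      (fun s hs hst hu => ?_)
    · rw [← hF.integral_secondMoment hne hn]
      exact integral_mono (hF.integrable_maxSecondMoment hne) (hF.integrable_secondMoment hne)
        hF.maxSecondMoment_le
    · have := integral_maxSecondMoment_le hH hF hne hX hE hn hs hst hu
      linarith

end Main

/-- The constant must be positive for all real parameters, admissible or not; a maximum with 1
ensures this without harming the bounds. -/
lemma one_div_max_mul_le {M R E : ℝ} (hM : 0 < M) (hE : 0 ≤ E) (h : E ≤ M * R) :
    1 / max M 1 * E ≤ R := by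
  have hR : 0 ≤ R := nonneg_of_mul_nonneg_right (hE.trans h) hM
  rw [one_div, inv_mul_le_iff₀ (zero_lt_one.trans_le (le_max_right _ _))]
  exact h.trans (by gcongr; exact le_max_left _ _)

lemma integral_supSum_nonneg {Ω S : Type*} [MeasurableSpace Ω] (μ : Measure Ω)
    (X : ℕ → Ω → S) (𝓕 : Set (S → ℝ)) (n : ℕ) : 0 ≤ ∫ ω, supSum X 𝓕 n ω ∂μ :=
  integral_nonneg fun ω => supSum_nonneg X 𝓕 n ω

end EmpiricalEntropy

theorem theorem3p1 :
    (∃ C : ℝ → ℝ → ℝ → ℝ, (∀ a c d, 0 < C a c d) ∧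
      ∀ (H : ℝ → ℝ) (A_H C_H D_H : ℝ),
        IsEntropyBound H → AdmissibleConstants H A_H C_H D_H →
      ∀ (S : Type u) [MeasurableSpace S] (P : Measure S) [IsProbabilityMeasure P]
        (Ω : Type v) [MeasurableSpace Ω] (μ : Measure Ω) [IsProbabilityMeasure μ]
        (X : ℕ → Ω → S) (𝓕 : Set (S → ℝ)) (F : S → ℝ) (σ : ℝ),
        IsSample μ P X → IsCenteredClass P 𝓕 F σ → EntropyCondition X 𝓕 F H →
      ∀ n : ℕ, 1 ≤ n →
        Integrable (supSum X 𝓕 n) μ ∧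
        1 / C A_H C_H D_H * ∫ ω, supSum X 𝓕 n ω ∂μ
          ≤ min (√n * l2norm P F)
              (max (max (√n * σ * √(H (2 * l2norm P F / σ)))
                  (H (min (2 * l2norm P F / σ) (√n * l2norm P F / (1440 * C_H)))))
                1) ∧
        1 / C A_H C_H D_H * ∫ ω, supSum X 𝓕 n ω ∂μ
          ≤ max (√n * σ * √(H (2 * l2norm P F / σ))) (H (2 * l2norm P F / σ))) ∧
    (∃ K : (ℝ → ℝ) → ℝ → ℝ, (∀ H c, 0 < K H c) ∧
      ∀ (H : ℝ → ℝ) (c : ℝ), IsEntropyBound H → 0 < c →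
      ∀ (S : Type u) [MeasurableSpace S] (P : Measure S) [IsProbabilityMeasure P]
        (Ω : Type v) [MeasurableSpace Ω] (μ : Measure Ω) [IsProbabilityMeasure μ]
        (X : ℕ → Ω → S) (𝓕 : Set (S → ℝ)) (F : S → ℝ) (σ : ℝ),
        IsSample μ P X → IsCenteredClass P 𝓕 F σ → EntropyCondition X 𝓕 F H →
      ∀ n : ℕ, 1 ≤ n → c * H (2 * l2norm P F / σ) ≤ n * σ ^ 2 →
        ∫ ω, supSum X 𝓕 n ω ∂μ ≤ K H c * (√n * σ * √(H (2 * l2norm P F / σ)))) := by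
  constructor
  · refine ⟨fun a c d => max (momentConst (4 * c) (1440 * c)
      (2 * rademacherConst (4 * c) ((d * Real.exp (-(4 * a)) / (2 * c)) ^ 2)) (64 * d ^ 2)) 1,
      fun a c d => zero_lt_one.trans_le (le_max_right _ _), ?_⟩
    intro H A C D hH hadm S _ P _ Ω _ μ _ X 𝓕 F σ hX hF hE n hn
    have hB := hH.dyadicBound hadm
    have hC := hadm.one_le_C
    -- The bounds hold with any `L ≥ 1` dividing `√n ‖F‖₂`; the value `1440 * C` is one such choice.
    obtain ⟨h1, h2⟩ := integral_supSum_le hB (hH.two_le_of_admissible hadm)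
      (L := 1440 * C) (by linarith) hX hF hE hn
    have hM := momentConst_pos (B := 4 * C) (L := 1440 * C) (h₁ := 64 * D ^ 2)
      (mul_pos two_pos hB.rademacherConst_pos) (by positivity)
    have h0 := integral_supSum_nonneg μ X 𝓕 n
    exact ⟨integrable_supSum hF hX, one_div_max_mul_le hM h0 h1, one_div_max_mul_le hM h0 h2⟩
  · have key : ∀ (H : ℝ → ℝ) (c : ℝ), ∃ K : ℝ, 0 < K ∧ (IsEntropyBound H → 0 < c →
        ∀ (S : Type u) [MeasurableSpace S] (P : Measure S) [IsProbabilityMeasure P]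
          (Ω : Type v) [MeasurableSpace Ω] (μ : Measure Ω) [IsProbabilityMeasure μ]
          (X : ℕ → Ω → S) (𝓕 : Set (S → ℝ)) (F : S → ℝ) (σ : ℝ),
          IsSample μ P X → IsCenteredClass P 𝓕 F σ → EntropyCondition X 𝓕 F H →
        ∀ n : ℕ, 1 ≤ n → c * H (2 * l2norm P F / σ) ≤ n * σ ^ 2 →
          ∫ ω, supSum X 𝓕 n ω ∂μ ≤ K * (√n * σ * √(H (2 * l2norm P F / σ)))) := by
      intro H c
      by_cases hHc : IsEntropyBound H ∧ 0 < c
      · obtain ⟨hH, hc⟩ := hHc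
        obtain ⟨B, hB⟩ := hH.exists_dyadicBound
        have hM := momentConst_pos (B := B) (L := 1)
          (mul_pos two_pos hB.rademacherConst_pos) hB.pos.le
        refine ⟨momentConst B 1 (2 * rademacherConst B (H 2)) (H 2) * (1 + 1 / √c),
          by positivity, fun _ _ S _ P _ Ω _ μ _ X 𝓕 F σ hX hF hE n hn hcn => ?_⟩
        have hσ := hF.sigma_pos
        have ht := hF.l2norm_pos
        exact le_of_entropy_le_variance hM hc hσ (by exact_mod_cast hn)
          (hB.nonneg _ (by positivity)) (integral_supSum_le hB le_rfl le_rfl hX hF hE hn).2 hcn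
      -- Default value of the constant when `H` or `c` is out of range.
      · exact ⟨1, one_pos, fun hH hc => absurd ⟨hH, hc⟩ hHc⟩
    choose K hK hK' using key
    exact ⟨K, hK, fun H c hH hc S _ P _ Ω _ μ _ X 𝓕 F σ hX hF hE n hn hcn =>
      hK' H c hH hc S P Ω μ X 𝓕 F σ hX hF hE n hn hcn⟩
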